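/- **Base.** Let $f$ be a homeomorphism of a compact metric space $X$ such that $(X,f)$ is one of the following, with contraction rate $\lambda\in(0,1)$, stable leaves $W^s(x)$ and local stable leaves $W^s_{loc}(x)$. 1. *Partially hyperbolic diffeomorphism* (Anosov diffeomorphisms included): $X$ is a compact connected manifold with the distance of a Riemannian metric, $f$ is a $C^1$ diffeomorphism, there are a $Df$-invariant splitting $TX=E^s\oplus E^c\oplus E^u$ with $E^s,E^u\ne0$ and positive continuous functions $\lambda(\cdot)<1$, $\hat\lambda(\cdot)<1$, $\xi,\hat\xi$ such that for all $x$ and all unit vectors $v^s,v^c,v^u$ in $E^s(x),E^c(x),E^u(x)$ $$\|Df_x v^s\|<\lambda(x)<\xi(x)<\|Df_x v^c\|<\hat\xi(x)^{-1}<\hat\lambda(x)^{-1}<\|Df_x v^u\|$$ (if $E^c=0$, the relations with $v^c$ are void). Put $\lambda=\max_x\lambda(x)$. $W^s(x)$ is the stable leaf of $x$ (the points joined to $x$ by $C^1$ curves tangent to $E^s$), and $W^s_{loc}(x)$ is the ball about $x$ in $W^s(x)$, for the length distance of the leaf, of a radius $\rho_0>0$ fixed so small that $$d_X(f^nx,f^ny)\le\lambda^n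 d_X(x,y)\quad\text{for all } x\in X,\ y\in W^s_{loc}(x),\ n\in\mathbb N.\tag{1}$$ 2. *Hyperbolic set*: $X$ is a compact hyperbolic set of a $C^1$ diffeomorphism between open subsets of a Riemannian manifold, with the induced distance, and $f$ is the restriction to $X$; the splitting is $E^s\oplus E^u$ over $X$, with $\|Df_xv^s\|<\lambda(x)<1$ and $1<\hat\lambda(x)^{-1}<\|Df_xv^u\|$ for unit vectors, where $\lambda(\cdot),\hat\lambda(\cdot)$ are positive and continuous, and $\lambda=\max_x\lambda(x)$. Here $W^s(x)=\{y\in X: d_X(f^nx,f^ny)\to0\}$ and $W^s_{loc}(x)=\{y\in X: d_X(f^nx,f^ny)\le\varepsilon\ \forall n\ge0\}$ with $\varepsilon>0$ fixed so small that (1) holds. 3. *Two-sided subshift of finite type*, with $d_X(x,y)=\lambda^{\min\{|i|:\,x_i\ne y_i\}}$ for $x\neq y$; $W^s(x)$ is the set of sequences agreeing with $x$ at all sufficiently large $i$, and $W^s_{loc}(x)$ the set of those agreeing with $x$ at all $i\ge0$. **Fiber.** Let $\mathcal M$ be a compact smooth manifold. Fix a smooth embedding $e:\mathcal M\to\mathbb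 R^N$ and finitely many charts $\varphi_c$ with closed balls $B_c$ in their images such that the preimages of the open balls cover $\mathcal M$. For $s=k+\alpha$ with $k\in\mathbb N=\{1,2,\dots\}$ and $0\le\alpha\le1$ (here $s=k+1$ with $\alpha=1$ stands for $C^{k,1}$: Lipschitz derivatives of order $k$), and $u:\mathcal M\to\mathbb R^N$, let $$[u]_{s}=\max_{1\le i\le k}\max_c\sup_{B_c}\|D^i(u\circ\varphi_c^{-1})\|+\max_c\sup_{v\ne w\in B_c}\frac{\|D^k_v(u\circ\varphi_c^{-1})-D^k_w(u\circ\varphi_c^{-1})\|}{|v-w|^{\alpha}},$$ where the last term is omitted if $\alpha=0$, and $\|u\|_{C^s}=\sup|u|+[u]_s$. For $g:\mathcal M\to\mathcal M$ let $\|g\|_{C^s}=\sup_t|e(g(t))-e(t)|+[e\circ g]_s$. $\mathrm{Diff}^s(\mathcal M)$ is the group of homeomorphisms $g$ such that $g,g^{-1}$ are $C^k$ and $|g|_{C^s}:=\|g\|_{C^s}+\|g^{-1}\|_{C^s}<\infty$, with the distance $$d_{C^s}(g,h)=\|e\circ g-e\circ h\|_{C^s}+\|e\circ g^{-1}-e\circ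 h^{-1}\|_{C^s}.$$ **Proposition.** Let $k\in\mathbb N$, $q=k+\gamma$ with $0<\gamma\le1$ (for $\gamma=1$, $C^q$ means $C^{k,1}$), $k\le r<q$, $\rho=q-r$ and $0<\beta\le1$. In norms and distances of order $r$ write $r=k+\alpha$ with $\alpha=r-k\in[0,\gamma)$. Let $A:X\to\mathrm{Diff}^q(\mathcal M)$ satisfy $d_{C^q}(A_x,A_y)\le c\,d_X(x,y)^\beta$ for all $x,y\in X$ and some constant $c$, and let $\mathcal A^n_x=A_{f^{n-1}x}\circ\cdots\circ A_x$, $\mathcal A^0_x=\mathrm{Id}$. Suppose that there are constants $\eta>0$ and $K$ such that $$\eta^{2(r+1)}\lambda^{\beta\rho}<1\quad\text{and}\quad|\mathcal A^n_x|_{C^q}\le K\eta^n\ \text{ for all }x\in X,\ n\in\mathbb N.$$ Then for all $x\in X$ and $y\in W^s(x)$ the limit $H_{x,y}=\lim_{n\to+\infty}(\mathcal A^n_y)^{-1}\circ\mathcal A^n_x$ exists in $\mathrm{Diff}^r(\mathcal M)$, and * (H1) $H_{x,x}=\mathrm{Id}$, $H_{y,z}\circ H_{x,y}=H_{x,z}$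 and $(H_{x,y})^{-1}=H_{y,x}$ for all $x\in X$ and $y,z\in W^s(x)$; * (H2) $H_{x,y}=(\mathcal A^n_y)^{-1}\circ H_{f^nx,f^ny}\circ\mathcal A^n_x$ for all $x\in X$, $y\in W^s(x)$, $n\ge0$; * (H3) there is a constant $c_1$ such that $d_{C^r}(H_{x,y},\mathrm{Id})\le c_1\,d_X(x,y)^{\beta\rho}$ for all $x\in X$ and $y\in W^s_{loc}(x)$; * (H4) the map $(x,y)\mapsto H_{x,y}$ into $\mathrm{Diff}^r(\mathcal M)$ is continuous on $\{(x,y):x\in X,\ y\in W^s_{loc}(x)\}$. -/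

import Mathlib

open Set Filter Topology Manifold Bundle
open scoped ENNReal ContDiff

universe u v

noncomputable section

/-! ## The fiber: `C^r` norms, distances and diffeomorphisms of a compact manifold -/

/-- Auxiliary data used to write down the `C^r` norms on a compact manifold `M`: finitely many
charts, in each of them a closed ball such that the corresponding open balls cover `M`, and a
smooth embedding of `M` in a Euclidean space (which makes differences of maps into `M`
meaningful).  Different choices give norms that are equivalent up to multiplicative constants. -/
structure NormData (d : ℕ) (M : Type v) [TopologicalSpace M]
    [ChartedSpace (EuclideanSpace ℝ (Fin d)) M] where
  /-- centers of the charts -/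
  centers : Finset M
  /-- radii of the balls in the charts -/
  radius : M → ℝ
  closedBall_subset : ∀ c ∈ centers,
    Metric.closedBall (extChartAt (𝓡 d) c c) (radius c) ⊆ (extChartAt (𝓡 d) c).target
  covers : ∀ t : M, ∃ c ∈ centers, t ∈ (extChartAt (𝓡 d) c).source ∧
    extChartAt (𝓡 d) c t ∈ Metric.ball (extChartAt (𝓡 d) c c) (radius c)
  /-- dimension of the ambient Euclidean space -/
  dim : ℕ
  /-- the embedding -/
  emb : M → EuclideanSpace ℝ (Fin dim)
  emb_smooth : ContMDiff (𝓡 d) (𝓡 dim) ∞ emb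
  emb_injective : Function.Injective emb
  emb_immersion : ∀ t : M, Function.Injective (mfderiv (𝓡 d) (𝓡 dim) emb t)

namespace NormData

variable {d : ℕ} {M : Type v} [TopologicalSpace M] [ChartedSpace (EuclideanSpace ℝ (Fin d)) M]

/-- The closed ball in the chart centered at `c`. -/
def chartBall (D : NormData d M) (c : M) : Set (EuclideanSpace ℝ (Fin d)) :=
  Metric.closedBall (extChartAt (𝓡 d) c c) (D.radius c)

/-- The derivative of order `i` of `u`, read in the chart centered at `c`. -/
def chartDeriv (D : NormData d M) (u : M → EuclideanSpace ℝ (Fin D.dim)) (i : ℕ) (c : M) :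
    EuclideanSpace ℝ (Fin d) → (EuclideanSpace ℝ (Fin d)) [×i]→L[ℝ] EuclideanSpace ℝ (Fin D.dim) :=
  iteratedFDeriv ℝ i (u ∘ (extChartAt (𝓡 d) c).symm)

/-- The part of the `C^{k+α}` norm that involves derivatives: the sup norms of the derivatives of
orders `1, …, k` and, if `α > 0`, the `α`-Hölder seminorm of the derivative of order `k`
(`α = 1` means Lipschitz). -/
def derivNorm (D : NormData d M) (k : ℕ) (α : ℝ) (u : M → EuclideanSpace ℝ (Fin D.dim)) : ℝ≥0∞ :=
  (⨆ i ∈ Finset.Icc 1 k, ⨆ c ∈ D.centers, ⨆ v ∈ D.chartBall c, ‖D.chartDeriv u i c v‖ₑ) +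
  if α = 0 then 0 else
    ⨆ c ∈ D.centers, ⨆ v ∈ D.chartBall c, ⨆ w ∈ D.chartBall c, ⨆ _ : v ≠ w,
      ‖D.chartDeriv u k c v - D.chartDeriv u k c w‖ₑ / edist v w ^ α

/-- The `C^{k+α}` norm of a map from `M` to the ambient Euclidean space. -/
def vecNorm (D : NormData d M) (k : ℕ) (α : ℝ) (u : M → EuclideanSpace ℝ (Fin D.dim)) : ℝ≥0∞ :=
  (⨆ t : M, ‖u t‖ₑ) + D.derivNorm k α u

/-- `‖g‖_{C^{k+α}}` for a map `g : M → M`; its `C^0` part is the largest displacement. -/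
def mapNorm (D : NormData d M) (k : ℕ) (α : ℝ) (g : M → M) : ℝ≥0∞ :=
  (⨆ t : M, edist (D.emb (g t)) (D.emb t)) + D.derivNorm k α (D.emb ∘ g)

/-- The `C^{k+α}` size `|g|_{C^{k+α}} = ‖g‖_{C^{k+α}} + ‖g⁻¹‖_{C^{k+α}}`. -/
def size (D : NormData d M) (k : ℕ) (α : ℝ) (g : M ≃ₜ M) : ℝ≥0∞ :=
  D.mapNorm k α g + D.mapNorm k α g.symm

/-- The distance `‖g - h‖_{C^{k+α}} + ‖g⁻¹ - h⁻¹‖_{C^{k+α}}` on `Diff^{k+α}(M)`. -/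
def diffDist (D : NormData d M) (k : ℕ) (α : ℝ) (g h : M ≃ₜ M) : ℝ≥0∞ :=
  D.vecNorm k α (fun t => D.emb (g t) - D.emb (h t)) +
  D.vecNorm k α (fun t => D.emb (g.symm t) - D.emb (h.symm t))

/-- `g ∈ Diff^{k+α}(M)`: both `g` and `g⁻¹` are `C^k` and, if `α > 0`, have `α`-Hölder derivatives
of order `k` (Lipschitz if `α = 1`). -/
structure MemDiff (D : NormData d M) (k : ℕ) (α : ℝ) (g : M ≃ₜ M) : Prop where
  contMDiff : ContMDiff (𝓡 d) (𝓡 d) k g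
  contMDiff_symm : ContMDiff (𝓡 d) (𝓡 d) k g.symm
  size_lt_top : D.size k α g < ⊤

end NormData

/-! ## Cocycles -/

/-- The iterates `A^n_x = A (f^{n-1} x) ∘ ⋯ ∘ A (f x) ∘ A x` of the cocycle over `f` generated
by `A`. -/
def cocycleIter {X : Type u} {M : Type v} [TopologicalSpace M]
    (f : X → X) (A : X → M ≃ₜ M) : ℕ → X → M ≃ₜ M
  | 0, _ => 1
  | n + 1, x => A (f^[n] x) * cocycleIter f A n x

/-! ## The base: partially hyperbolic and hyperbolic systems -/

/-- The sets `Wloc x` satisfy `d (f^n x, f^n y) ≤ λ^n d (x, y)` for all `y ∈ Wloc x`. -/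
def ContractsLocally {X : Type u} [MetricSpace X] (f : X → X) (lam : ℝ) (Wloc : X → Set X) :
    Prop :=
  ∀ x, ∀ y ∈ Wloc x, ∀ n : ℕ, dist (f^[n] x) (f^[n] y) ≤ lam ^ n * dist x y

section Manifold

variable {m : ℕ} {X : Type u} [MetricSpace X] [ChartedSpace (EuclideanSpace ℝ (Fin m)) X]
  [IsManifold (𝓡 m) ∞ X] [RiemannianBundle (fun x : X => TangentSpace (𝓡 m) x)]

/-- `f` is a partially hyperbolic diffeomorphism with (nontrivial, `Df`-invariant) splitting
`TX = E^s ⊕ E^c ⊕ E^u` and rates `λ(x) = ls x`, `λ̂(x) = lu x`, `ξ(x) = xs x`, `ξ̂(x) = xu x`.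
The center bundle may be zero, in which case `f` is Anosov. -/
structure IsPartiallyHyperbolic (f : X ≃ₜ X)
    (Es Ec Eu : ∀ x : X, Submodule ℝ (TangentSpace (𝓡 m) x)) (ls lu xs xu : X → ℝ) : Prop where
  contMDiff : ContMDiff (𝓡 m) (𝓡 m) 1 f
  contMDiff_symm : ContMDiff (𝓡 m) (𝓡 m) 1 f.symm
  splitting : ∀ x, DirectSum.IsInternal
    (![Es x, Ec x, Eu x] : Fin 3 → Submodule ℝ (TangentSpace (𝓡 m) x))
  stable_nontrivial : ∀ x, Es x ≠ ⊥
  unstable_nontrivial : ∀ x, Eu x ≠ ⊥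
  map_stable : ∀ x, (Es x).map (mfderiv (𝓡 m) (𝓡 m) f x).toLinearMap = Es (f x)
  map_center : ∀ x, (Ec x).map (mfderiv (𝓡 m) (𝓡 m) f x).toLinearMap = Ec (f x)
  map_unstable : ∀ x, (Eu x).map (mfderiv (𝓡 m) (𝓡 m) f x).toLinearMap = Eu (f x)
  continuous_rates : Continuous ls ∧ Continuous lu ∧ Continuous xs ∧ Continuous xu
  pos_rates : ∀ x, 0 < ls x ∧ 0 < lu x ∧ 0 < xs x ∧ 0 < xu x
  rates_lt_one : ∀ x, ls x < 1 ∧ lu x < 1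
  rates_lt : ∀ x, ls x < xs x ∧ (xu x)⁻¹ < (lu x)⁻¹
  bound_stable : ∀ x, ∀ w ∈ Es x, ‖w‖ = 1 → ‖mfderiv (𝓡 m) (𝓡 m) f x w‖ < ls x
  bound_center : ∀ x, ∀ w ∈ Ec x, ‖w‖ = 1 →
    xs x < ‖mfderiv (𝓡 m) (𝓡 m) f x w‖ ∧ ‖mfderiv (𝓡 m) (𝓡 m) f x w‖ < (xu x)⁻¹
  bound_unstable : ∀ x, ∀ w ∈ Eu x, ‖w‖ = 1 → (lu x)⁻¹ < ‖mfderiv (𝓡 m) (𝓡 m) f x w‖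

/-- `γ : [0, 1] → X` is a `C^1` curve from `x` to `y` tangent to the distribution `Es`. -/
structure IsTangentCurve (Es : ∀ x : X, Submodule ℝ (TangentSpace (𝓡 m) x)) (x y : X)
    (γ : ℝ → X) : Prop where
  contMDiffOn : ContMDiffOn 𝓘(ℝ, ℝ) (𝓡 m) 1 γ (Icc 0 1)
  source : γ 0 = x
  target : γ 1 = y
  tangent : ∀ s ∈ Icc (0 : ℝ) 1,
    (mfderivWithin 𝓘(ℝ, ℝ) (𝓡 m) γ (Icc 0 1) s : ℝ →L[ℝ] TangentSpace (𝓡 m) (γ s)) 1 ∈ Es (γ s)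

/-- The leaf through `x` of the foliation tangent to `Es`: the points that can be reached from `x`
by a curve tangent to `Es`. -/
def leaf (Es : ∀ x : X, Submodule ℝ (TangentSpace (𝓡 m) x)) (x : X) : Set X :=
  {y | ∃ γ : ℝ → X, IsTangentCurve Es x y γ}

/-- The ball of radius `ρ` about `x` in its leaf, with respect to the length distance of the
leaf. -/
def leafBall (Es : ∀ x : X, Submodule ℝ (TangentSpace (𝓡 m) x)) (ρ : ℝ) (x : X) : Set X :=
  {y | ∃ γ : ℝ → X, IsTangentCurve Es x y γ ∧ pathELength (𝓡 m) γ 0 1 < ENNReal.ofReal ρ}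

/-- The isometrically embedded set `ι(X)` is a hyperbolic set of `F`, a `C^1` diffeomorphism of an
open neighborhood `U` of `ι(X)` onto its image in the Riemannian manifold `N`, with splitting
`T_pN = E^s ⊕ E^u` for `p ∈ ι(X)` (the values of `Es`, `Eu` off `ι(X)` are irrelevant) and rates
`λ(x) = ls x`, `λ̂(x) = lu x`; and `f` is the restriction of `F` to this set. -/
structure IsHyperbolicSet {N : Type u} [MetricSpace N]
    [ChartedSpace (EuclideanSpace ℝ (Fin m)) N] [IsManifold (𝓡 m) ∞ N]
    [RiemannianBundle (fun x : N => TangentSpace (𝓡 m) x)] {X : Type u} [MetricSpace X]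
    (F : N → N) (U : Set N) (ι : X → N) (f : X ≃ₜ X)
    (Es Eu : ∀ p : N, Submodule ℝ (TangentSpace (𝓡 m) p)) (ls lu : X → ℝ) : Prop where
  isOpen : IsOpen U
  contMDiffOn : ContMDiffOn (𝓡 m) (𝓡 m) 1 F U
  injOn : InjOn F U
  bijective_mfderiv : ∀ p ∈ U, Function.Bijective (mfderiv (𝓡 m) (𝓡 m) F p)
  isometry : Isometry ι
  mem : ∀ x, ι x ∈ U
  semiconj : ∀ x, F (ι x) = ι (f x)
  splitting : ∀ x, IsCompl (Es (ι x)) (Eu (ι x))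
  map_stable : ∀ x, (Es (ι x)).map (mfderiv (𝓡 m) (𝓡 m) F (ι x)).toLinearMap = Es (F (ι x))
  map_unstable : ∀ x, (Eu (ι x)).map (mfderiv (𝓡 m) (𝓡 m) F (ι x)).toLinearMap = Eu (F (ι x))
  continuous_rates : Continuous ls ∧ Continuous lu
  pos_rates : ∀ x, 0 < ls x ∧ 0 < lu x
  rates_lt_one : ∀ x, ls x < 1 ∧ lu x < 1
  bound_stable : ∀ x, ∀ w ∈ Es (ι x), ‖w‖ = 1 → ‖mfderiv (𝓡 m) (𝓡 m) F (ι x) w‖ < ls x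
  bound_unstable : ∀ x, ∀ w ∈ Eu (ι x), ‖w‖ = 1 →
    (lu x)⁻¹ < ‖mfderiv (𝓡 m) (𝓡 m) F (ι x) w‖

end Manifold

/-- `f` is a partially hyperbolic diffeomorphism of a compact connected manifold whose distance
comes from the Riemannian metric in the definition of partial hyperbolicity, `lam` is the maximum
of `λ(x)`, `Ws x` is the leaf of the stable foliation, and `Wloc x` is the ball about `x` in the
stable leaf of a radius `ρ` so small that `f` contracts local stable leaves. -/
def PartiallyHyperbolicBase {X : Type u} [MetricSpace X] (f : X ≃ₜ X) (lam : ℝ)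
    (Ws Wloc : X → Set X) : Prop :=
  ∃ (m : ℕ) (_ : ChartedSpace (EuclideanSpace ℝ (Fin m)) X) (_ : IsManifold (𝓡 m) ∞ X)
    (_ : RiemannianBundle (fun x : X => TangentSpace (𝓡 m) x))
    (_ : IsContMDiffRiemannianBundle (𝓡 m) ∞ (EuclideanSpace ℝ (Fin m))
      (fun x : X => TangentSpace (𝓡 m) x))
    (_ : IsRiemannianManifold (𝓡 m) X)
    (Es Ec Eu : ∀ x : X, Submodule ℝ (TangentSpace (𝓡 m) x)) (ls lu xs xu : X → ℝ) (ρ : ℝ),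
    CompactSpace X ∧ ConnectedSpace X ∧ IsPartiallyHyperbolic f Es Ec Eu ls lu xs xu ∧
    IsGreatest (range ls) lam ∧ Ws = leaf Es ∧
    0 < ρ ∧ Wloc = leafBall Es ρ ∧ ContractsLocally f lam Wloc

/-- `f` is the restriction of a diffeomorphism to a compact hyperbolic set, `lam` is the maximum of
`λ(x)`, `Ws x` is the stable set of `x`, and `Wloc x` is the local stable set of a size `ε` so small
that `f` contracts local stable sets. -/
def HyperbolicSetBase {X : Type u} [MetricSpace X] (f : X ≃ₜ X) (lam : ℝ)
    (Ws Wloc : X → Set X) : Prop :=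
  ∃ (m : ℕ) (N : Type u) (_ : MetricSpace N) (_ : ChartedSpace (EuclideanSpace ℝ (Fin m)) N)
    (_ : IsManifold (𝓡 m) ∞ N) (_ : RiemannianBundle (fun p : N => TangentSpace (𝓡 m) p))
    (_ : IsContMDiffRiemannianBundle (𝓡 m) ∞ (EuclideanSpace ℝ (Fin m))
      (fun p : N => TangentSpace (𝓡 m) p))
    (_ : IsRiemannianManifold (𝓡 m) N)
    (F : N → N) (U : Set N) (ι : X → N)
    (Es Eu : ∀ p : N, Submodule ℝ (TangentSpace (𝓡 m) p)) (ls lu : X → ℝ) (ε : ℝ),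
    CompactSpace X ∧ IsHyperbolicSet F U ι f Es Eu ls lu ∧ IsGreatest (range ls) lam ∧
    (∀ x, Ws x = {y | Tendsto (fun n : ℕ => dist (f^[n] x) (f^[n] y)) atTop (𝓝 0)}) ∧
    0 < ε ∧ (∀ x, Wloc x = {y | ∀ n : ℕ, dist (f^[n] x) (f^[n] y) ≤ ε}) ∧
    ContractsLocally f lam Wloc

/-- `(X, f)` is (via the coding `e`) a two-sided subshift of finite type with transition rule `T`,
with the metric `d (x, y) = lam ^ min {|i| : x_i ≠ y_i}`, `Ws x` consists of the sequences that
eventually agree with `x`, and `Wloc x` of those that agree with `x` at all `i ≥ 0`. -/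
def SubshiftBase {X : Type u} [MetricSpace X] (f : X ≃ₜ X) (lam : ℝ)
    (Ws Wloc : X → Set X) : Prop :=
  ∃ (l : ℕ) (T : Fin l → Fin l → Prop) (e : X → ℤ → Fin l),
    0 < lam ∧ lam < 1 ∧ Function.Injective e ∧ range e = {a | ∀ i, T (a i) (a (i + 1))} ∧
    (∀ x i, e (f x) i = e x (i + 1)) ∧
    (∀ x y, x ≠ y → dist x y = lam ^ sInf {n : ℕ | ∃ i : ℤ, i.natAbs = n ∧ e x i ≠ e y i}) ∧
    (∀ x, Ws x = {y | ∃ n : ℤ, ∀ i ≥ n, e y i = e x i}) ∧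
    (∀ x, Wloc x = {y | ∀ i ≥ (0 : ℤ), e y i = e x i})

/-- `(X, f)` is a partially hyperbolic or hyperbolic system with contraction rate `lam` along the
stable leaves, stable leaves `Ws x` and local stable leaves `Wloc x`.  (Anosov diffeomorphisms are
partially hyperbolic diffeomorphisms with zero center bundle.) -/
def IsBaseSystem {X : Type u} [MetricSpace X] (f : X ≃ₜ X) (lam : ℝ) (Ws Wloc : X → Set X) :
    Prop :=
  PartiallyHyperbolicBase f lam Ws Wloc ∨ HyperbolicSetBase f lam Ws Wloc ∨
    SubshiftBase f lam Ws Wloc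

end

noncomputable section

/-! ## Quantitative calculus in normed spaces -/

section TaylorComp

variable {E F G : Type*} [NormedAddCommGroup E] [NormedSpace ℝ E] [NormedAddCommGroup F]
  [NormedSpace ℝ F] [NormedAddCommGroup G] [NormedSpace ℝ G]

/-! Put `h_n = (A^n_y)⁻¹ ∘ A^n_x`, `x_n = f^n x`, `y_n = f^n y`, `α = r - k` and `ρ = q - r = γ -
α`. Consecutive approximations differ by one inner factor: `h_{n+1} = G ∘ Δ ∘ F` and `h_n = G ∘ F`,
where `G = (A^n_y)⁻¹`, `F = A^n_x` and `Δ = (A_{y_n})⁻¹ ∘ A_{x_n}`. Since `A` is Hölder, `Δ` is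
within `δ ≲ d(x_n, y_n)^β` of the identity in `C^{k+γ}`. The top derivative of `G` is only
`γ`-Hölder, so `G ∘ Δ - G` is of size `η^n δ^γ` in `C^k` and merely bounded by a multiple of `η^n`
in `C^{k+γ}`. Interpolation gives `η^n δ^ρ` in `C^{k+α}`, and composing with `F` costs a further
factor `(η^n)^{k+1}`. Along exponentially asymptotic orbits the increment is therefore at most a
constant times `θ^n` with `θ = η^{k+2} λ^{βρ}`. Bunching gives `θ < 1`, because `k + 2 ≤ 2(r + 1)`
(after replacing `η` by `max η 1`). The inverse of `h_n` for `(x, y)` is `h_n` for `(y, x)`, so the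
inverses converge in the same way and the limit is a diffeomorphism. The step estimate is
`CocycleBound.exists_step_bound`; summation is `CocycleBound.exists_holonomy`.

Differences of maps of `M` make sense only after the embedding in `ℝ^N`. `NormData.exists_extension`
extends functions on `M` to `ℝ^N` with linear control of the norms. Thus `u ∘ F` becomes `g ∘ (emb ∘
F)` with `g` defined on a vector space, and every estimate reduces to the Faà di Bruno formula for
`JetBound`, with no charts needed on the target side.

(H1) and (H2) are identities between the approximations that pass to the limit. (H3) is the
convergence estimate at `n = 0`, where the approximation is the identity. (H4) holds because
convergence is uniform over local leaves and each approximation is continuous: iterates are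
continuous in `C^k` and bounded in `C^{k+γ}`, hence continuous in `C^{k+α}` by interpolation.

On the base, only two facts are used: local leaves contract at rate `λ`, and points of one stable
leaf eventually lie in a common local leaf (`IsBaseSystem.contracts`). -/

theorem norm_taylorComp_le {n k : ℕ} (hn : n ≤ k) {q : FormalMultilinearSeries ℝ F G}
    {p : FormalMultilinearSeries ℝ E F} {U L : ℝ} (hL : 1 ≤ L)
    (hq : ∀ j ≤ k, ‖q j‖ ≤ U) (hp : ∀ j ≤ k, ‖p j‖ ≤ L) :
    ‖q.taylorComp p n‖ ≤ Fintype.card (OrderedFinpartition n) * (U * L ^ k) := by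
  have hU : 0 ≤ U := (norm_nonneg _).trans (hq 0 (Nat.zero_le _))
  rw [FormalMultilinearSeries.taylorComp]
  refine (norm_sum_le_of_le (f := fun c => q.compAlongOrderedFinpartition p c)
    (n := fun _ => U * L ^ k) _ fun c _ => ?_).trans (by simp)
  refine (c.norm_compAlongOrderedFinpartition_le _ _).trans ?_
  have hc : c.length ≤ k := c.length_le.trans hn
  calc ‖q c.length‖ * ∏ i, ‖p (c.partSize i)‖
      ≤ U * ∏ _i : Fin c.length, L := by
        gcongr with i _
        · exact hq _ hc
        · exact hp _ ((c.partSize_le i).trans hn)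
    _ ≤ U * L ^ k := by
        rw [Finset.prod_const, Finset.card_univ, Fintype.card_fin]
        gcongr

/-- Each Faà di Bruno term is multilinear, so its inputs can be exchanged one at a time: at most `k`
exchanges of an inner derivative cost `ε` each, and one exchange of the outer derivative costs `δ`.
-/
theorem norm_taylorComp_sub_le {n k : ℕ} (hn : n ≤ k) {q q' : FormalMultilinearSeries ℝ F G}
    {p p' : FormalMultilinearSeries ℝ E F} {U L ε δ : ℝ} (hL : 1 ≤ L)
    (hq : ∀ j ≤ k, ‖q j‖ ≤ U) (hqq : ∀ j ≤ k, ‖q j - q' j‖ ≤ δ)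
    (hp : ∀ j ≤ k, ‖p j‖ ≤ L) (hp' : ∀ j ≤ k, ‖p' j‖ ≤ L) (hpp : ∀ j ≤ k, ‖p j - p' j‖ ≤ ε) :
    ‖q.taylorComp p n - q'.taylorComp p' n‖ ≤
      Fintype.card (OrderedFinpartition n) * (U * k * L ^ k * ε + δ * L ^ k) := by
  have hU : 0 ≤ U := (norm_nonneg _).trans (hq 0 (Nat.zero_le _))
  have hδ : 0 ≤ δ := (norm_nonneg _).trans (hqq 0 (Nat.zero_le _))
  have hε : 0 ≤ ε := (norm_nonneg _).trans (hpp 0 (Nat.zero_le _))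
  rw [FormalMultilinearSeries.taylorComp, FormalMultilinearSeries.taylorComp,
    ← Finset.sum_sub_distrib]
  refine (norm_sum_le_of_le (n := fun _ => U * k * L ^ k * ε + δ * L ^ k) _ fun c _ => ?_).trans
    (by simp [mul_add])
  refine (c.norm_compAlongOrderedFinpartition_sub_compAlongOrderedFinpartition_le _ _ _ _).trans ?_
  have hc : c.length ≤ k := c.length_le.trans hn
  have hs : ∀ i, c.partSize i ≤ k := fun i => (c.partSize_le i).trans hn
  have hpi : ‖fun m => p (c.partSize m)‖ ≤ L :=
    (pi_norm_le_iff_of_nonneg (by linarith)).2 fun i => hp _ (hs i)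
  have hpi' : ‖fun m => p' (c.partSize m)‖ ≤ L :=
    (pi_norm_le_iff_of_nonneg (by linarith)).2 fun i => hp' _ (hs i)
  have hppi : ‖(fun m => p (c.partSize m)) - fun m => p' (c.partSize m)‖ ≤ ε :=
    (pi_norm_le_iff_of_nonneg hε).2 fun i => hpp _ (hs i)
  have hck : (c.length : ℝ) ≤ k := by exact_mod_cast hc
  gcongr ?_ + ?_
  · have h1 : max ‖fun m => p (c.partSize m)‖ ‖fun m => p' (c.partSize m)‖ ^ (c.length - 1)
        ≤ L ^ k :=
      (pow_le_pow_left₀ (by positivity) (max_le hpi hpi') _).trans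
        (pow_le_pow_right₀ hL ((Nat.sub_le _ _).trans hc))
    gcongr
    exact hq _ hc
  · calc ‖q c.length - q' c.length‖ * ∏ i, ‖p' (c.partSize i)‖
        ≤ δ * ∏ _i : Fin c.length, L := by
          gcongr with i _
          · exact hqq _ hc
          · exact hp' _ (hs i)
      _ ≤ δ * L ^ k := by
          rw [Finset.prod_const, Finset.card_univ, Fintype.card_fin]
          gcongr

/-- The number of terms in the Faà di Bruno formulas of all orders up to `k`. -/
def faaDiBrunoTerms (k : ℕ) : ℝ :=
  ∑ n ∈ Finset.range (k + 1), (Fintype.card (OrderedFinpartition n) : ℝ)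

theorem card_le_faaDiBrunoTerms {n k : ℕ} (hn : n ≤ k) :
    (Fintype.card (OrderedFinpartition n) : ℝ) ≤ faaDiBrunoTerms k :=
  Finset.single_le_sum (f := fun n => (Fintype.card (OrderedFinpartition n) : ℝ))
    (fun _ _ => Nat.cast_nonneg _) (Finset.mem_range.2 (Nat.lt_succ_of_le hn))

theorem faaDiBrunoTerms_nonneg (k : ℕ) : 0 ≤ faaDiBrunoTerms k :=
  Finset.sum_nonneg fun _ _ => Nat.cast_nonneg _

end TaylorComp

/-- On the set `S`, the function `f` is `C^k`, its derivatives of order at most `k` are bounded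
by `B`, and the derivative of order `k` is `α`-Hölder with constant `B`. -/
structure JetBound {E F : Type*} [NormedAddCommGroup E] [NormedSpace ℝ E] [NormedAddCommGroup F]
    [NormedSpace ℝ F] (k : ℕ) (α : ℝ) (f : E → F) (S : Set E) (B : ℝ) : Prop where
  contDiffAt : ∀ x ∈ S, ContDiffAt ℝ k f x
  norm_le : ∀ j ≤ k, ∀ x ∈ S, ‖iteratedFDeriv ℝ j f x‖ ≤ B
  holder : ∀ x ∈ S, ∀ y ∈ S,
    ‖iteratedFDeriv ℝ k f x - iteratedFDeriv ℝ k f y‖ ≤ B * ‖x - y‖ ^ α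

/-! ### Sums, products, compositions, interpolation and series of Hölder jets -/

namespace JetBound

variable {E F G : Type*} [NormedAddCommGroup E] [NormedSpace ℝ E] [NormedAddCommGroup F]
  [NormedSpace ℝ F] [NormedAddCommGroup G] [NormedSpace ℝ G]
  {k : ℕ} {α γ : ℝ} {f f' : E → F} {g : F → G} {S : Set E} {T : Set F} {B B' L δ : ℝ}

theorem mono (h : JetBound k α f S B) (hB : B ≤ B') : JetBound k α f S B' where
  contDiffAt := h.contDiffAt
  norm_le j hj x hx := (h.norm_le j hj x hx).trans hB
  holder x hx y hy := (h.holder x hx y hy).trans (by gcongr)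

theorem mono_set (h : JetBound k α f S B) {S' : Set E} (hS : S' ⊆ S) : JetBound k α f S' B where
  contDiffAt x hx := h.contDiffAt x (hS hx)
  norm_le j hj x hx := h.norm_le j hj x (hS hx)
  holder x hx y hy := h.holder x (hS hx) y (hS hy)

theorem nonneg (h : JetBound k α f S B) (hS : S.Nonempty) : 0 ≤ B :=
  (norm_nonneg _).trans (h.norm_le 0 (Nat.zero_le _) hS.some hS.some_mem)

theorem norm_apply_le (h : JetBound k α f S B) {x : E} (hx : x ∈ S) : ‖f x‖ ≤ B := by
  simpa using h.norm_le 0 (Nat.zero_le _) x hx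

theorem add (h : JetBound k α f S B) (h' : JetBound k α f' S B') :
    JetBound k α (fun x => f x + f' x) S (B + B') where
  contDiffAt x hx := (h.contDiffAt x hx).add (h'.contDiffAt x hx)
  norm_le j hj x hx := by
    rw [fun_iteratedFDeriv_add_apply ((h.contDiffAt x hx).of_le (mod_cast hj))
      ((h'.contDiffAt x hx).of_le (mod_cast hj))]
    exact norm_add_le_of_le (h.norm_le j hj x hx) (h'.norm_le j hj x hx)
  holder x hx y hy := by
    rw [fun_iteratedFDeriv_add_apply (h.contDiffAt x hx) (h'.contDiffAt x hx),
      fun_iteratedFDeriv_add_apply (h.contDiffAt y hy) (h'.contDiffAt y hy), add_sub_add_comm,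
      add_mul]
    exact norm_add_le_of_le (h.holder x hx y hy) (h'.holder x hx y hy)

theorem sub (h : JetBound k α f S B) (h' : JetBound k α f' S B') :
    JetBound k α (fun x => f x - f' x) S (B + B') where
  contDiffAt x hx := (h.contDiffAt x hx).sub (h'.contDiffAt x hx)
  norm_le j hj x hx := by
    rw [fun_iteratedFDeriv_sub_apply ((h.contDiffAt x hx).of_le (mod_cast hj))
      ((h'.contDiffAt x hx).of_le (mod_cast hj))]
    exact norm_sub_le_of_le (h.norm_le j hj x hx) (h'.norm_le j hj x hx)
  holder x hx y hy := by
    rw [fun_iteratedFDeriv_sub_apply (h.contDiffAt x hx) (h'.contDiffAt x hx),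
      fun_iteratedFDeriv_sub_apply (h.contDiffAt y hy) (h'.contDiffAt y hy), sub_sub_sub_comm,
      add_mul]
    exact norm_sub_le_of_le (h.holder x hx y hy) (h'.holder x hx y hy)

/-- Derivatives of order less than `k` are Lipschitz. -/
theorem norm_sub_le_of_lt (h : JetBound k α f S B) (hS : Convex ℝ S) {j : ℕ} (hj : j < k)
    {x y : E} (hx : x ∈ S) (hy : y ∈ S) :
    ‖iteratedFDeriv ℝ j f x - iteratedFDeriv ℝ j f y‖ ≤ B * ‖x - y‖ := by
  refine hS.norm_image_sub_le_of_norm_fderiv_le (𝕜 := ℝ) (fun z hz => ?_) (fun z hz => ?_) hy hx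
  · exact (h.contDiffAt z hz).differentiableAt_iteratedFDeriv (mod_cast hj)
  · rw [norm_fderiv_iteratedFDeriv]
    exact h.norm_le (j + 1) hj z hz

theorem lipschitz (h : JetBound k α f S B) (hS : Convex ℝ S) (hk : 1 ≤ k)
    {x y : E} (hx : x ∈ S) (hy : y ∈ S) : ‖f x - f y‖ ≤ B * ‖x - y‖ := by
  have := h.norm_sub_le_of_lt hS hk hx hy
  rwa [iteratedFDeriv_zero_eq_comp, Function.comp_apply, Function.comp_apply, ← map_sub,
    LinearIsometryEquiv.norm_map] at this

/-- Below the top order the derivatives are Lipschitz, which beats `α`-Hölder at distances at most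
`1`; at larger distances the sup bound, applied twice, suffices. Hence the factor `2`. -/
theorem norm_sub_le (h : JetBound k α f S B) (hS : Convex ℝ S) (hα : 0 ≤ α) (hα' : α ≤ 1) {j : ℕ}
    (hj : j ≤ k) {x y : E} (hx : x ∈ S) (hy : y ∈ S) :
    ‖iteratedFDeriv ℝ j f x - iteratedFDeriv ℝ j f y‖ ≤ 2 * B * ‖x - y‖ ^ α := by
  have hB : 0 ≤ B := h.nonneg ⟨x, hx⟩
  have hp : 0 ≤ ‖x - y‖ ^ α := by positivity
  rcases hj.lt_or_eq with hj' | rfl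
  · rcases le_total ‖x - y‖ 1 with h1 | h1
    · refine (h.norm_sub_le_of_lt hS hj' hx hy).trans ?_
      have : ‖x - y‖ ≤ ‖x - y‖ ^ α := by
        simpa using Real.rpow_le_rpow_of_exponent_ge_of_imp (norm_nonneg _) h1 hα' (by simp)
      nlinarith [mul_le_mul_of_nonneg_left this hB]
    · refine (norm_sub_le_of_le (h.norm_le j hj x hx) (h.norm_le j hj y hy)).trans ?_
      have : 1 ≤ ‖x - y‖ ^ α := Real.one_le_rpow h1 hα
      nlinarith
  · refine (h.holder x hx y hy).trans ?_
    nlinarith [mul_nonneg hB hp]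

/-- The bound is linear in `B`, which keeps the growth rate low when iterates are composed. Faà di
Bruno products give `L ^ k`; the last factor `L` comes from the Hölder seminorm, either as the
constant of an inner derivative or from `‖f x - f y‖ ^ α ≤ L * ‖x - y‖ ^ α`. -/
theorem comp (hg : JetBound k α g T B) (hf : JetBound k α f S L) (hT : Convex ℝ T)
    (hS : Convex ℝ S) (hfT : MapsTo f S T) (hk : 1 ≤ k) (hα : 0 ≤ α) (hα' : α ≤ 1) (hL : 1 ≤ L) :
    JetBound k α (g ∘ f) S (faaDiBrunoTerms k * (2 * k + 2) * (B * L ^ (k + 1))) where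
  contDiffAt x hx := (hg.contDiffAt _ (hfT hx)).comp x (hf.contDiffAt x hx)
  norm_le j hj x hx := by
    have hB : 0 ≤ B := hg.nonneg ⟨_, hfT hx⟩
    rw [iteratedFDeriv_comp (hg.contDiffAt _ (hfT hx)) (hf.contDiffAt x hx) (mod_cast hj)]
    refine (norm_taylorComp_le hj hL (fun i hi => hg.norm_le i hi _ (hfT hx))
      (fun i hi => hf.norm_le i hi x hx)).trans ?_
    have h0 := faaDiBrunoTerms_nonneg k
    have h1 : B * L ^ k ≤ B * L ^ (k + 1) := by gcongr; exact Nat.le_succ k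
    have h2 : (1 : ℝ) ≤ 2 * k + 2 := by have : (0 : ℝ) ≤ k := Nat.cast_nonneg k; linarith
    have h3 : 0 ≤ B * L ^ (k + 1) := by positivity
    calc _ ≤ faaDiBrunoTerms k * (B * L ^ (k + 1)) := by
            gcongr; exact card_le_faaDiBrunoTerms hj
      _ ≤ _ := by
        rw [mul_assoc]
        exact mul_le_mul_of_nonneg_left (le_mul_of_one_le_left h3 h2) h0
  holder x hx y hy := by
    have hB : 0 ≤ B := hg.nonneg ⟨_, hfT hx⟩
    rw [iteratedFDeriv_comp (hg.contDiffAt _ (hfT hx)) (hf.contDiffAt x hx) le_rfl,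
      iteratedFDeriv_comp (hg.contDiffAt _ (hfT hy)) (hf.contDiffAt y hy) le_rfl]
    have hfx : ‖f x - f y‖ ^ α ≤ L * ‖x - y‖ ^ α := by
      calc ‖f x - f y‖ ^ α ≤ (L * ‖x - y‖) ^ α := by
            gcongr; exact hf.lipschitz hS hk hx hy
        _ = L ^ α * ‖x - y‖ ^ α := Real.mul_rpow (by positivity) (norm_nonneg _)
        _ ≤ L * ‖x - y‖ ^ α := by
            gcongr; simpa using Real.rpow_le_rpow_of_exponent_le hL hα'
    refine (norm_taylorComp_sub_le (k := k) (δ := 2 * B * (L * ‖x - y‖ ^ α))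
      (ε := 2 * L * ‖x - y‖ ^ α) le_rfl hL
      (fun i hi => hg.norm_le i hi _ (hfT hx))
      (fun i hi => (hg.norm_sub_le hT hα hα' hi (hfT hx) (hfT hy)).trans (by gcongr))
      (fun i hi => hf.norm_le i hi x hx) (fun i hi => hf.norm_le i hi y hy)
      (fun i hi => hf.norm_sub_le hS hα hα' hi hx hy)).trans ?_
    have h0 := card_le_faaDiBrunoTerms (le_refl k)
    calc _ ≤ faaDiBrunoTerms k * (B * k * L ^ k * (2 * L * ‖x - y‖ ^ α) +
          2 * B * (L * ‖x - y‖ ^ α) * L ^ k) := by gcongr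
      _ = _ := by ring

/-- For exponent `0` the Hölder condition bounds the oscillation of the top derivative, at most
twice its sup norm. -/
theorem of_norm_le (hc : ∀ x ∈ S, ContDiffAt ℝ k f x)
    (h : ∀ j ≤ k, ∀ x ∈ S, ‖iteratedFDeriv ℝ j f x‖ ≤ B) : JetBound k 0 f S (2 * B) where
  contDiffAt := hc
  norm_le j hj x hx := by
    have := (norm_nonneg _).trans (h j hj x hx)
    linarith [h j hj x hx]
  holder x hx y hy := by
    rw [Real.rpow_zero, mul_one, two_mul]
    exact norm_sub_le_of_le (h k le_rfl x hx) (h k le_rfl y hy)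

/-- The derivatives of `g` at `f x` and `f' x` differ by at most `2 * B * δ ^ γ`. With only a Hölder
top derivative of `g`, closeness is measured in `C^k` and the power `δ ^ γ` replaces `δ`. -/
theorem comp_sub_comp (hg : JetBound k γ g T B) (hf : JetBound k γ f S L)
    (hf' : JetBound k γ f' S L) (hff : JetBound k 0 (fun x => f x - f' x) S δ) (hT : Convex ℝ T)
    (hfT : MapsTo f S T) (hfT' : MapsTo f' S T) (hγ : 0 ≤ γ) (hγ' : γ ≤ 1)
    (hL : 1 ≤ L) (hδ : δ ≤ 2 * L) :
    JetBound k 0 (fun x => g (f x) - g (f' x)) S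
      (2 * (faaDiBrunoTerms k * (2 * k + 2) * (B * L ^ (k + 1) * δ ^ γ))) := by
  have hc : ∀ x ∈ S, ContDiffAt ℝ k (g ∘ f) x := fun x hx =>
    (hg.contDiffAt _ (hfT hx)).comp x (hf.contDiffAt x hx)
  have hc' : ∀ x ∈ S, ContDiffAt ℝ k (g ∘ f') x := fun x hx =>
    (hg.contDiffAt _ (hfT' hx)).comp x (hf'.contDiffAt x hx)
  refine of_norm_le (fun x hx => (hc x hx).sub (hc' x hx)) fun j hj x hx => ?_
  have hB : 0 ≤ B := hg.nonneg ⟨_, hfT hx⟩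
  have hδ0 : 0 ≤ δ := hff.nonneg ⟨x, hx⟩
  -- For `δ ≤ 1` this is `δ ≤ δ ^ γ`; for `δ ≥ 1` it is the hypothesis `δ ≤ 2 * L`. It lets the
  -- error of the inner derivatives be absorbed into the `δ ^ γ` term.
  have hδγ : δ ≤ 2 * L * δ ^ γ := by
    rcases le_total δ 1 with h1 | h1
    · have : δ ≤ δ ^ γ := by
        simpa using Real.rpow_le_rpow_of_exponent_ge_of_imp hδ0 h1 hγ' (by simp)
      nlinarith [Real.rpow_nonneg hδ0 γ]
    · have : 1 ≤ δ ^ γ := Real.one_le_rpow h1 hγ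
      nlinarith
  rw [fun_iteratedFDeriv_sub_apply (f := fun x => g (f x)) (g := fun x => g (f' x))
    ((hc x hx).of_le (mod_cast hj)) ((hc' x hx).of_le (mod_cast hj))]
  change ‖iteratedFDeriv ℝ j (g ∘ f) x - iteratedFDeriv ℝ j (g ∘ f') x‖ ≤ _
  rw [iteratedFDeriv_comp (hg.contDiffAt _ (hfT hx)) (hf.contDiffAt x hx) (mod_cast hj),
    iteratedFDeriv_comp (hg.contDiffAt _ (hfT' hx)) (hf'.contDiffAt x hx) (mod_cast hj)]
  refine (norm_taylorComp_sub_le (k := k) (δ := 2 * B * δ ^ γ) (ε := 2 * L * δ ^ γ) hj hL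
    (fun i hi => hg.norm_le i hi _ (hfT hx))
    (fun i hi => (hg.norm_sub_le hT hγ hγ' hi (hfT hx) (hfT' hx)).trans ?_)
    (fun i hi => hf.norm_le i hi x hx) (fun i hi => hf'.norm_le i hi x hx)
    (fun i hi => le_trans ?_ hδγ)).trans ?_
  · gcongr
    exact hff.norm_apply_le hx
  · have := hff.norm_le i hi x hx
    rwa [fun_iteratedFDeriv_sub_apply ((hf.contDiffAt x hx).of_le (mod_cast hi))
      ((hf'.contDiffAt x hx).of_le (mod_cast hi))] at this
  · have h0 := card_le_faaDiBrunoTerms hj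
    have h1 : L ^ k ≤ L ^ (k + 1) := pow_le_pow_right₀ hL (Nat.le_succ k)
    calc _ ≤ faaDiBrunoTerms k * (B * k * L ^ k * (2 * L * δ ^ γ) +
          2 * B * δ ^ γ * L ^ (k + 1)) := by
            have : 0 ≤ δ ^ γ := by positivity
            have := faaDiBrunoTerms_nonneg k
            gcongr
      _ = _ := by ring

/-- An increment `t` of the top derivative satisfies `t ≤ a` and `t ≤ b * ‖x - y‖ ^ γ`; the
geometric mean with weight `α / γ` gives Hölder exponent `α`. The condition `a ≤ b` serves the sup
bounds, where only `a` is available. -/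
theorem interpolate {a b : ℝ} (ha : JetBound k 0 f S a) (hb : JetBound k γ f S b) (hγ : 0 < γ)
    (hα : 0 ≤ α) (hαγ : α ≤ γ) (hab : a ≤ b) :
    JetBound k α f S (a ^ (1 - α / γ) * b ^ (α / γ)) := by
  have hs : 0 ≤ α / γ := by positivity
  have hs' : 0 ≤ 1 - α / γ := by rw [sub_nonneg, div_le_one hγ]; exact hαγ
  refine ⟨ha.contDiffAt, fun j hj x hx => (ha.norm_le j hj x hx).trans ?_, fun x hx y hy => ?_⟩
  · have ha0 : 0 ≤ a := ha.nonneg ⟨x, hx⟩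
    calc a = a ^ (1 - α / γ) * a ^ (α / γ) := by
          rw [← Real.rpow_add_of_nonneg ha0 hs' hs, sub_add_cancel, Real.rpow_one]
      _ ≤ _ := by gcongr
  · have ha0 : 0 ≤ a := ha.nonneg ⟨x, hx⟩
    have hb0 : 0 ≤ b := ha0.trans hab
    set t := ‖iteratedFDeriv ℝ k f x - iteratedFDeriv ℝ k f y‖
    have ht : 0 ≤ t := norm_nonneg _
    have h1 : t ≤ a := by simpa using ha.holder x hx y hy
    have h2 : t ≤ b * ‖x - y‖ ^ γ := hb.holder x hx y hy
    calc t = t ^ (1 - α / γ) * t ^ (α / γ) := by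
          rw [← Real.rpow_add_of_nonneg ht hs' hs, sub_add_cancel, Real.rpow_one]
      _ ≤ a ^ (1 - α / γ) * (b * ‖x - y‖ ^ γ) ^ (α / γ) := by gcongr
      _ = _ := by
        rw [Real.mul_rpow hb0 (by positivity), ← Real.rpow_mul (norm_nonneg _),
          mul_div_cancel₀ _ hγ.ne', mul_assoc]

theorem _root_.norm_iteratedFDeriv_smul_le_of_contDiffAt {χ : E → ℝ} {x : E}
    (hχ : ContDiffAt ℝ k χ x) (hf : ContDiffAt ℝ k f x) {n : ℕ} (hn : n ≤ k) :
    ‖iteratedFDeriv ℝ n (fun y => χ y • f y) x‖ ≤ ∑ i ∈ Finset.range (n + 1),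
      (n.choose i : ℝ) * ‖iteratedFDeriv ℝ i χ x‖ * ‖iteratedFDeriv ℝ (n - i) f x‖ := by
  obtain ⟨V, hV, hxV, h⟩ : ∃ V : Set E, IsOpen V ∧ x ∈ V ∧
      ∀ y ∈ V, ContDiffAt ℝ k χ y ∧ ContDiffAt ℝ k f y := by
    obtain ⟨V, hV, hVo, hxV⟩ := eventually_nhds_iff.1
      ((hχ.eventually (by simp)).and (hf.eventually (by simp)))
    exact ⟨V, hVo, hxV, hV⟩
  have := norm_iteratedFDerivWithin_smul_le (𝕜 := ℝ)
    (fun y hy => (h y hy).1.contDiffWithinAt) (fun y hy => (h y hy).2.contDiffWithinAt)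
    hV.uniqueDiffOn hxV (mod_cast hn : (n : ℕ∞ω) ≤ k)
  simpa only [iteratedFDerivWithin_of_isOpen _ hV hxV] using this

theorem smul {χ : E → ℝ} {A : ℝ} (hχ : JetBound k α χ S A) (hf : JetBound k α f S B)
    (hS : Convex ℝ S) (hα : 0 ≤ α) (hα' : α ≤ 1) :
    JetBound k α (fun x => χ x • f x) S (2 ^ (k + 2) * (A * B)) := by
  have key : ∀ (a b : ℝ) (χ' : E → ℝ) (f' : E → F) (x : E), 0 ≤ a → 0 ≤ b →
      ContDiffAt ℝ k χ' x → ContDiffAt ℝ k f' x →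
      (∀ j ≤ k, ‖iteratedFDeriv ℝ j χ' x‖ ≤ a) → (∀ j ≤ k, ‖iteratedFDeriv ℝ j f' x‖ ≤ b) →
      ∀ j ≤ k, ‖iteratedFDeriv ℝ j (fun y => χ' y • f' y) x‖ ≤ 2 ^ k * (a * b) := by
    intro a b χ' f' x ha hb h1 h2 h3 h4 j hj
    refine (norm_iteratedFDeriv_smul_le_of_contDiffAt h1 h2 hj).trans ?_
    calc _ ≤ ∑ i ∈ Finset.range (j + 1), (j.choose i : ℝ) * a * b := by
          gcongr with i hi
          · exact h3 _ ((Nat.lt_succ_iff.1 (Finset.mem_range.1 hi)).trans hj)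
          · exact h4 _ ((Nat.sub_le _ _).trans hj)
      _ = 2 ^ j * (a * b) := by
          simp_rw [mul_assoc]
          rw [← Finset.sum_mul, ← Nat.cast_sum, Nat.sum_range_choose]
          push_cast
          ring
      _ ≤ _ := by
          gcongr
          exact one_le_two
  have hA0 : ∀ x ∈ S, 0 ≤ A := fun x hx => hχ.nonneg ⟨x, hx⟩
  have hB0 : ∀ x ∈ S, 0 ≤ B := fun x hx => hf.nonneg ⟨x, hx⟩
  refine ⟨fun x hx => (hχ.contDiffAt x hx).smul (hf.contDiffAt x hx), fun j hj x hx => ?_,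
    fun x hx y hy => ?_⟩
  · refine (key A B χ f x (hA0 x hx) (hB0 x hx) (hχ.contDiffAt x hx) (hf.contDiffAt x hx)
      (fun i hi => hχ.norm_le i hi x hx) (fun i hi => hf.norm_le i hi x hx) j hj).trans ?_
    have := mul_nonneg (hA0 x hx) (hB0 x hx)
    gcongr
    · exact one_le_two
    · omega
  · have hA := hA0 x hx
    have hB := hB0 x hx
    have hxy : x + (y - x) = y := by abel
    have c1 : ContDiffAt ℝ k (fun z => χ (z + (y - x))) x := by
      refine ContDiffAt.comp (g := χ) (f := fun z => z + (y - x)) x ?_ (by fun_prop)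
      rw [hxy]; exact hχ.contDiffAt y hy
    have c2 : ContDiffAt ℝ k (fun z => f (z + (y - x))) x := by
      refine ContDiffAt.comp (g := f) (f := fun z => z + (y - x)) x ?_ (by fun_prop)
      rw [hxy]; exact hf.contDiffAt y hy
    have d1 := hχ.contDiffAt x hx
    have d2 := hf.contDiffAt x hx
    have t1 : ∀ j, iteratedFDeriv ℝ j (fun z => χ (z + (y - x))) x = iteratedFDeriv ℝ j χ y := by
      intro j; rw [iteratedFDeriv_comp_add_right, hxy]
    have t2 : ∀ j, iteratedFDeriv ℝ j (fun z => f (z + (y - x))) x = iteratedFDeriv ℝ j f y := by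
      intro j; rw [iteratedFDeriv_comp_add_right, hxy]
    -- With `v = y - x`, the increment of the derivative is the derivative at `x` of the increment
    -- under translation by `v`. The product rule for differences then reduces the Hölder bound to
    -- two uses of the Leibniz estimate `key`.
    have e : iteratedFDeriv ℝ k (fun z => χ z • f z) y - iteratedFDeriv ℝ k (fun z => χ z • f z) x
        = iteratedFDeriv ℝ k (fun z => (χ (z + (y - x)) - χ z) • f (z + (y - x))) x
          + iteratedFDeriv ℝ k (fun z => χ z • (f (z + (y - x)) - f z)) x := by
      have e1 : iteratedFDeriv ℝ k (fun z => χ (z + (y - x)) • f (z + (y - x))) x =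
          iteratedFDeriv ℝ k (fun z => χ z • f z) y := by
        rw [iteratedFDeriv_comp_add_right (f := fun z => χ z • f z), hxy]
      have c3 : ContDiffAt ℝ k (fun z => χ (z + (y - x)) • f (z + (y - x))) x := c1.smul c2
      have d3 : ContDiffAt ℝ k (fun z => χ z • f z) x := d1.smul d2
      have c4 : ContDiffAt ℝ k (fun z => (χ (z + (y - x)) - χ z) • f (z + (y - x))) x :=
        (c1.sub d1).smul c2
      have d4 : ContDiffAt ℝ k (fun z => χ z • (f (z + (y - x)) - f z)) x := d1.smul (c2.sub d2)
      rw [← e1, ← fun_iteratedFDeriv_sub_apply c3 d3, ← fun_iteratedFDeriv_add_apply c4 d4]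
      congr 1
      ext z
      simp only [sub_smul, smul_sub]
      abel
    rw [norm_sub_rev, e]
    refine (norm_add_le_of_le (key (2 * A * ‖x - y‖ ^ α) B _ _ x (by positivity) hB (c1.sub d1) c2
      (fun j hj => ?_) (fun j hj => ?_) k le_rfl) (key A (2 * B * ‖x - y‖ ^ α) _ _ x hA
      (by positivity) d1 (c2.sub d2) (fun j hj => hχ.norm_le j hj x hx)
      (fun j hj => ?_) k le_rfl)).trans (le_of_eq ?_)
    · rw [fun_iteratedFDeriv_sub_apply (c1.of_le (mod_cast hj)) (d1.of_le (mod_cast hj)), t1,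
        norm_sub_rev]
      exact hχ.norm_sub_le hS hα hα' hj hx hy
    · rw [t2]; exact hf.norm_le j hj y hy
    · rw [fun_iteratedFDeriv_sub_apply (c2.of_le (mod_cast hj)) (d2.of_le (mod_cast hj)), t2,
        norm_sub_rev]
      exact hf.norm_sub_le hS hα hα' hj hx hy
    · ring

/-- One extra derivative makes the derivative of order `k` Lipschitz on a compact convex set; a
Lipschitz bound is a Hölder bound up to a factor controlled by the diameter. -/
theorem exists_of_isCompact (hS : IsCompact S) (hc : Convex ℝ S)
    (hf : ∀ x ∈ S, ContDiffAt ℝ (k + 1) f x) (hα : 0 ≤ α) (hα' : α ≤ 1) :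
    ∃ B, JetBound k α f S B := by
  have : ∀ j : ℕ, ∃ b : ℝ, 0 ≤ b ∧ (j ≤ k + 1 → ∀ x ∈ S, ‖iteratedFDeriv ℝ j f x‖ ≤ b) := by
    intro j
    by_cases hj : j ≤ k + 1
    · obtain ⟨b, hb⟩ := hS.exists_bound_of_continuousOn (f := iteratedFDeriv ℝ j f)
        fun x hx => ((hf x hx).continuousAt_iteratedFDeriv (mod_cast hj)).continuousWithinAt
      exact ⟨max b 0, le_max_right _ _, fun _ x hx => (hb x hx).trans (le_max_left _ _)⟩
    · exact ⟨0, le_rfl, fun h => absurd h hj⟩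
  choose b hb0 hb using this
  obtain ⟨R, hR⟩ := hS.isBounded.exists_norm_le
  set B := ∑ j ∈ Finset.range (k + 2), b j
  have hbB : ∀ j ≤ k + 1, b j ≤ B := fun j hj =>
    Finset.single_le_sum (fun i _ => hb0 i) (Finset.mem_range.2 (by omega))
  have hB0 : 0 ≤ B := Finset.sum_nonneg fun i _ => hb0 i
  refine ⟨B * (1 + 2 * |R|), fun x hx => (hf x hx).of_le (mod_cast Nat.le_succ k),
    fun j hj x hx => ?_, fun x hx y hy => ?_⟩
  · refine (hb j (by omega) x hx).trans ((hbB j (by omega)).trans ?_)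
    nlinarith [abs_nonneg R]
  · have h1 : ‖iteratedFDeriv ℝ k f x - iteratedFDeriv ℝ k f y‖ ≤ B * ‖x - y‖ := by
      refine hc.norm_image_sub_le_of_norm_fderiv_le (𝕜 := ℝ) (fun z hz => ?_) (fun z hz => ?_) hy hx
      · exact (hf z hz).differentiableAt_iteratedFDeriv (mod_cast Nat.lt_succ_self k)
      · rw [norm_fderiv_iteratedFDeriv]
        exact (hb (k + 1) le_rfl z hz).trans (hbB _ le_rfl)
    have h2 : ‖x - y‖ ≤ (1 + 2 * |R|) * ‖x - y‖ ^ α := by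
      rcases le_total ‖x - y‖ 1 with h | h
      · have : ‖x - y‖ ≤ ‖x - y‖ ^ α := by
          simpa using Real.rpow_le_rpow_of_exponent_ge_of_imp (norm_nonneg _) h hα' (by simp)
        nlinarith [abs_nonneg R, Real.rpow_nonneg (norm_nonneg (x - y)) α]
      · have h3 : 1 ≤ ‖x - y‖ ^ α := Real.one_le_rpow h hα
        have h4 := norm_sub_le_of_le (hR x hx) (hR y hy)
        nlinarith [abs_nonneg R, le_abs_self R]
    calc _ ≤ B * ‖x - y‖ := h1
      _ ≤ B * ((1 + 2 * |R|) * ‖x - y‖ ^ α) := by gcongr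
      _ = _ := by ring

theorem tsum [CompleteSpace F] {f : ℕ → E → F} {b : ℕ → ℝ}
    (h : ∀ n, JetBound k α (f n) univ (b n)) (hb : Summable b) :
    JetBound k α (fun x => ∑' n, f n x) univ (∑' n, b n) := by
  have hd : ∀ n, ContDiff ℝ ((k : ℕ∞) : ℕ∞ω) (f n) := fun n =>
    contDiff_iff_contDiffAt.2 fun x => (h n).contDiffAt x (mem_univ x)
  have hle : ∀ (j n : ℕ) (x : E), (j : ℕ∞) ≤ (k : ℕ∞) → ‖iteratedFDeriv ℝ j (f n) x‖ ≤ b n :=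
    fun j n x hj => (h n).norm_le j (mod_cast hj) x (mem_univ x)
  have hs : ∀ (j : ℕ), j ≤ k → ∀ x, Summable fun n => iteratedFDeriv ℝ j (f n) x :=
    fun j hj x => .of_norm_bounded hb fun n => hle j n x (mod_cast hj)
  refine ⟨fun x _ => (contDiff_tsum (v := fun _ => b) hd (fun _ _ => hb)
    (fun j n x hj => hle j n x hj)).contDiffAt, fun j hj x _ => ?_, fun x _ y _ => ?_⟩
  · rw [iteratedFDeriv_tsum_apply (v := fun _ => b) hd (fun _ _ => hb) hle (mod_cast hj)]
    exact tsum_of_norm_bounded hb.hasSum fun n => hle j n x (mod_cast hj)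
  · rw [iteratedFDeriv_tsum_apply (v := fun _ => b) hd (fun _ _ => hb) hle (mod_cast le_rfl),
      iteratedFDeriv_tsum_apply (v := fun _ => b) hd (fun _ _ => hb) hle (mod_cast le_rfl),
      ← (hs k le_rfl x).tsum_sub (hs k le_rfl y)]
    exact tsum_of_norm_bounded (hb.hasSum.mul_right _) fun n =>
      (h n).holder x (mem_univ x) y (mem_univ y)

end JetBound

/-! ## Extension of functions from the compact manifold to the ambient Euclidean space -/

namespace JetBound

variable {E F G : Type*} [NormedAddCommGroup E] [NormedSpace ℝ E] [NormedAddCommGroup F]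
  [NormedSpace ℝ F] {k : ℕ} {α : ℝ}

theorem zero {S : Set E} : JetBound k α (fun _ : E => (0 : F)) S 0 where
  contDiffAt _ _ := contDiffAt_const
  norm_le j _ x _ := by simp
  holder x _ y _ := by simp

theorem sum {ι : Type*} (s : Finset ι) {f : ι → E → F} {B : ι → ℝ} {S : Set E}
    (h : ∀ i ∈ s, JetBound k α (f i) S (B i)) :
    JetBound k α (fun x => ∑ i ∈ s, f i x) S (∑ i ∈ s, B i) := by
  classical
  induction s using Finset.induction_on with
  | empty => simpa using zero
  | insert i s hi ih =>
    simp only [Finset.sum_insert hi]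
    exact (h i (Finset.mem_insert_self i s)).add
      (ih fun j hj => h j (Finset.mem_insert_of_mem hj))

/-- Extension by zero of functions supported in a fixed compact subset of an open set. -/
theorem exists_extend_zero {K S : Set E} (hK : IsCompact K) (hS : IsOpen S) (hKS : K ⊆ S)
    (hα : 0 ≤ α) : ∃ C : ℝ, 1 ≤ C ∧ ∀ (f : E → F) (B : ℝ), 0 ≤ B → (∀ x ∉ K, f x = 0) →
      JetBound k α f S B → JetBound k α f univ (C * B) := by
  obtain ⟨δ, hδ, hδS⟩ := hK.exists_thickening_subset_open hS hKS
  have hC : (1 : ℝ) ≤ 1 + (δ ^ α)⁻¹ := by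
    have : 0 ≤ (δ ^ α)⁻¹ := by positivity
    linarith
  refine ⟨1 + (δ ^ α)⁻¹, hC, fun f B hB hf h => ?_⟩
  have hev : ∀ x ∉ K, f =ᶠ[𝓝 x] fun _ => 0 := fun x hx => by
    filter_upwards [hK.isClosed.isOpen_compl.mem_nhds hx] with y hy using hf y hy
  have hz : ∀ x ∉ K, ∀ j, iteratedFDeriv ℝ j f x = 0 := fun x hx j => by
    rw [((hev x hx).iteratedFDeriv ℝ j).eq_of_nhds]; simp
  have hBC : B ≤ (1 + (δ ^ α)⁻¹) * B := le_mul_of_one_le_left hB hC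
  -- A point of `K` and a point outside `S` are at distance at least `δ`, so the sup bound already
  -- yields a Hölder bound with the extra factor `(δ ^ α)⁻¹`.
  have key : ∀ x ∈ S, ∀ y ∉ S,
      ‖iteratedFDeriv ℝ k f x‖ ≤ (1 + (δ ^ α)⁻¹) * B * ‖x - y‖ ^ α := by
    intro x hx y hy
    by_cases hxK : x ∈ K
    · have hd : δ ≤ ‖x - y‖ := by
        by_contra! hlt
        exact hy (hδS (Metric.mem_thickening_iff.2 ⟨x, hxK, by rwa [dist_comm, dist_eq_norm]⟩))
      have h1 : δ ^ α ≤ ‖x - y‖ ^ α := by gcongr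
      have h2 : 1 ≤ (δ ^ α)⁻¹ * ‖x - y‖ ^ α := by
        rw [inv_mul_eq_div, one_le_div (by positivity)]; exact h1
      have h3 : 0 ≤ ‖x - y‖ ^ α := by positivity
      calc _ ≤ B := h.norm_le k le_rfl x hx
        _ ≤ B * ((δ ^ α)⁻¹ * ‖x - y‖ ^ α) := le_mul_of_one_le_right hB h2
        _ ≤ _ := by nlinarith [mul_nonneg hB h3]
    · rw [hz x hxK, norm_zero]; positivity
  refine ⟨fun x _ => ?_, fun j hj x _ => ?_, fun x _ y _ => ?_⟩
  · by_cases hx : x ∈ K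
    · exact h.contDiffAt x (hKS hx)
    · exact contDiffAt_const.congr_of_eventuallyEq (hev x hx)
  · by_cases hx : x ∈ K
    · exact (h.norm_le j hj x (hKS hx)).trans hBC
    · rw [hz x hx, norm_zero]; positivity
  · by_cases hx : x ∈ S <;> by_cases hy : y ∈ S
    · exact (h.holder x hx y hy).trans (by gcongr)
    · rw [hz y (fun hyK => hy (hKS hyK)), sub_zero]
      exact key x hx y hy
    · rw [hz x (fun hxK => hx (hKS hxK)), zero_sub, norm_neg, norm_sub_rev x y]
      exact key y hy x hx
    · rw [hz y (fun hyK => hy (hKS hyK)), hz x (fun hxK => hx (hKS hxK)), sub_zero, norm_zero]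
      positivity

end JetBound

namespace NormData

variable {d : ℕ} {M : Type v} [TopologicalSpace M] [ChartedSpace (EuclideanSpace ℝ (Fin d)) M]

theorem convex_chartBall (D : NormData d M) (c : M) : Convex ℝ (D.chartBall c) :=
  convex_closedBall _ _

theorem isCompact_chartBall (D : NormData d M) (c : M) : IsCompact (D.chartBall c) :=
  isCompact_closedBall _ _

/-- The derivatives of `u` of order at most `k`, read in the charts of `D`, are bounded by `B`,
and those of order `k` are `α`-Hölder with constant `B`. -/
def MapBound (D : NormData d M) (k : ℕ) (α : ℝ) (u : M → EuclideanSpace ℝ (Fin D.dim)) (B : ℝ) :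
    Prop :=
  ∀ c ∈ D.centers, JetBound k α (u ∘ (extChartAt (𝓡 d) c).symm) (D.chartBall c) B

theorem exists_mem_chartBall (D : NormData d M) (t : M) : ∃ c ∈ D.centers,
    t ∈ (extChartAt (𝓡 d) c).source ∧ extChartAt (𝓡 d) c t ∈ D.chartBall c := by
  obtain ⟨c, hc, hs, hb⟩ := D.covers t
  exact ⟨c, hc, hs, Metric.ball_subset_closedBall hb⟩

namespace MapBound

variable {D : NormData d M} {k : ℕ} {α : ℝ} {u u' : M → EuclideanSpace ℝ (Fin D.dim)}
  {B B' : ℝ}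

theorem mono (h : D.MapBound k α u B) (hB : B ≤ B') : D.MapBound k α u B' :=
  fun c hc => (h c hc).mono hB

theorem add (h : D.MapBound k α u B) (h' : D.MapBound k α u' B') :
    D.MapBound k α (fun t => u t + u' t) (B + B') :=
  fun c hc => (h c hc).add (h' c hc)

theorem sub (h : D.MapBound k α u B) (h' : D.MapBound k α u' B') :
    D.MapBound k α (fun t => u t - u' t) (B + B') :=
  fun c hc => (h c hc).sub (h' c hc)

theorem norm_apply_le (h : D.MapBound k α u B) (t : M) : ‖u t‖ ≤ B := by
  obtain ⟨c, hc, hs, hb⟩ := D.exists_mem_chartBall t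
  have := (h c hc).norm_apply_le hb
  rwa [Function.comp_apply, PartialEquiv.left_inv _ hs] at this

theorem nonneg [Nonempty M] (h : D.MapBound k α u B) : 0 ≤ B :=
  (norm_nonneg _).trans (h.norm_apply_le (Classical.arbitrary M))

theorem contMDiff [IsManifold (𝓡 d) ∞ M] (h : D.MapBound k α u B) :
    ContMDiff (𝓡 d) (𝓡 D.dim) k u := by
  intro t
  obtain ⟨c, hc, hs, hb⟩ := D.exists_mem_chartBall t
  have h1 : ContMDiffAt (𝓡 d) (𝓡 d) k (extChartAt (𝓡 d) c) t :=
    (contMDiffAt_extChartAt' (n := ∞) (by simpa using hs)).of_le (mod_cast le_top)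
  have h2 := ((h c hc).contDiffAt _ hb).contMDiffAt.comp t h1
  refine h2.congr_of_eventuallyEq ?_
  filter_upwards [extChartAt_source_mem_nhds' hs] with y hy
  rw [Function.comp_apply, Function.comp_apply, PartialEquiv.left_inv _ hy]

end MapBound

theorem contDiffAt_comp_symm [IsManifold (𝓡 d) ∞ M] (D : NormData d M) {n : ℕ∞}
    {F : Type*} [NormedAddCommGroup F] [NormedSpace ℝ F]
    {u : M → F} (hu : ContMDiff (𝓡 d) 𝓘(ℝ, F) n u)
    {c : M} (hc : c ∈ D.centers) {x : EuclideanSpace ℝ (Fin d)} (hx : x ∈ D.chartBall c) :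
    ContDiffAt ℝ n (u ∘ (extChartAt (𝓡 d) c).symm) x := by
  have hx' := D.closedBall_subset c hc hx
  have h1 : ContMDiffAt (𝓡 d) (𝓡 d) n (extChartAt (𝓡 d) c).symm x :=
    ((contMDiffOn_extChartAt_symm (n := ∞) c).contMDiffAt
      ((isOpen_extChartAt_target c).mem_nhds hx')).of_le (mod_cast le_top)
  exact (hu.contMDiffAt.comp x h1).contDiffAt

theorem isClosedEmbedding_emb [CompactSpace M] (D : NormData d M) : IsClosedEmbedding D.emb :=
  D.emb_smooth.continuous.isClosedEmbedding D.emb_injective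

theorem exists_mapBound_emb [IsManifold (𝓡 d) ∞ M] (D : NormData d M) (k : ℕ) {α : ℝ}
    (hα : 0 ≤ α) (hα' : α ≤ 1) : ∃ B, D.MapBound k α D.emb B := by
  have : ∀ c, ∃ B, c ∈ D.centers →
      JetBound k α (D.emb ∘ (extChartAt (𝓡 d) c).symm) (D.chartBall c) B := by
    intro c
    by_cases hc : c ∈ D.centers
    · obtain ⟨B, hB⟩ := JetBound.exists_of_isCompact (k := k) (D.isCompact_chartBall c)
        (D.convex_chartBall c) (fun x hx => (D.contDiffAt_comp_symm D.emb_smooth hc hx).of_le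
          (by exact_mod_cast le_top)) hα hα'
      exact ⟨B, fun _ => hB⟩
    · exact ⟨0, fun h => absurd h hc⟩
  choose B hB using this
  refine ⟨∑ c ∈ D.centers, |B c|, fun c hc => (hB c hc).mono ?_⟩
  exact (le_abs_self _).trans
    (Finset.single_le_sum (f := fun c => |B c|) (fun _ _ => abs_nonneg _) hc)

/-- Near each of its points, the embedded manifold has a chart that extends to the ambient
space. -/
theorem exists_ambient_chart [IsManifold (𝓡 d) ∞ M] [CompactSpace M] (D : NormData d M) (n : ℕ)
    (s : M) : ∃ c ∈ D.centers,
      ∃ (Q : EuclideanSpace ℝ (Fin D.dim) → EuclideanSpace ℝ (Fin d)) (ε : ℝ), 0 < ε ∧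
      (∀ a ∈ Metric.closedBall (D.emb s) ε, ContDiffAt ℝ n Q a ∧ Q a ∈ D.chartBall c) ∧
      ∀ t, D.emb t ∈ Metric.closedBall (D.emb s) ε →
        t ∈ (extChartAt (𝓡 d) c).source ∧ Q (D.emb t) = extChartAt (𝓡 d) c t := by
  obtain ⟨c, hc, hs, hb⟩ := D.covers s
  refine ⟨c, hc, ?_⟩
  set x := extChartAt (𝓡 d) c s with hx
  set p := D.emb ∘ (extChartAt (𝓡 d) c).symm with hp
  have hxt : x ∈ (extChartAt (𝓡 d) c).target := (extChartAt (𝓡 d) c).map_source hs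
  have hPx : (extChartAt (𝓡 d) c).symm x = s := (extChartAt (𝓡 d) c).left_inv hs
  have hpC : ContDiffAt ℝ ∞ p x :=
    D.contDiffAt_comp_symm D.emb_smooth hc (Metric.ball_subset_closedBall hb)
  have hinj : Function.Injective (fderiv ℝ p x) := by
    have h1 : MDifferentiableAt (𝓡 d) (𝓡 d) (extChartAt (𝓡 d) c).symm x :=
      (((contMDiffOn_extChartAt_symm (n := ∞) c).contMDiffAt
        ((isOpen_extChartAt_target c).mem_nhds hxt))).mdifferentiableAt (by simp)
    have h2 : MDifferentiableAt (𝓡 d) (𝓡 D.dim) D.emb ((extChartAt (𝓡 d) c).symm x) :=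
      D.emb_smooth.mdifferentiableAt (by simp)
    have h3 := isInvertible_mfderivWithin_extChartAt_symm (I := 𝓡 d) (x := c) hxt
    rw [ModelWithCorners.range_eq_univ, mfderivWithin_univ] at h3
    rw [← mfderiv_eq_fderiv, hp, mfderiv_comp x h2 h1]
    exact (D.emb_immersion _).comp h3.injective
  -- Following the embedding by a linear left inverse `Λ` of its derivative gives a map between
  -- spaces of equal dimension with derivative the identity. Its local inverse `ψ` yields the
  -- ambient chart `ψ ∘ Λ`.
  obtain ⟨Λ, hΛ⟩ := ContinuousLinearMap.HasLeftInverse.of_injective_of_finiteDimensional hinj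
  have hΛp : ContDiffAt ℝ (n + 1 : ℕ) (Λ ∘ p) x :=
    (Λ.contDiff.contDiffAt.comp x hpC).of_le (by exact_mod_cast le_top)
  have hd : HasFDerivAt (Λ ∘ p)
      (ContinuousLinearEquiv.refl ℝ (EuclideanSpace ℝ (Fin d)) : _ →L[ℝ] _) x := by
    have := Λ.hasFDerivAt.comp x (hpC.differentiableAt (by simp)).hasFDerivAt
    convert! this using 1
    ext1 v
    exact (hΛ v).symm
  have hn0 : ((n + 1 : ℕ) : ℕ∞ω) ≠ 0 := by exact_mod_cast Nat.succ_ne_zero n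
  set ψ := hΛp.localInverse hd hn0
  have hψ : ContDiffAt ℝ (n + 1 : ℕ) ψ (Λ (D.emb s)) := by
    have := hΛp.to_localInverse hd hn0
    have e : (Λ ∘ p) x = Λ (D.emb s) := by rw [Function.comp_apply, hp, Function.comp_apply, hPx]
    rwa [e] at this
  have hleft : ∀ᶠ v in 𝓝 x, ψ (Λ (p v)) = v :=
    (hΛp.hasStrictFDerivAt' hd hn0).eventually_left_inverse
  have hφ : ContinuousAt (extChartAt (𝓡 d) c) s := continuousAt_extChartAt' hs
  have hev : ∀ᶠ t in 𝓝 s, t ∈ (extChartAt (𝓡 d) c).source ∧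
      ψ (Λ (D.emb t)) = extChartAt (𝓡 d) c t := by
    filter_upwards [extChartAt_source_mem_nhds' hs, hφ.eventually hleft] with t ht h
    rw [hp, Function.comp_apply, PartialEquiv.left_inv _ ht] at h
    exact ⟨ht, h⟩
  have hQ : ContDiffAt ℝ (n + 1 : ℕ) (ψ ∘ Λ) (D.emb s) :=
    hψ.comp _ Λ.contDiff.contDiffAt
  have hQs : (ψ ∘ Λ) (D.emb s) = x := hev.self_of_nhds.2
  have hball : ∀ᶠ a in 𝓝 (D.emb s), (ψ ∘ Λ) a ∈ D.chartBall c := by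
    refine hQ.continuousAt.eventually_mem ?_
    rw [hQs]
    exact Filter.mem_of_superset (Metric.isOpen_ball.mem_nhds hb) Metric.ball_subset_closedBall
  -- Since `emb` is a topological embedding, a property near `s` holds for every `t` in `M` whose
  -- image is close to `emb s`, even if other parts of `M` a priori return near that image.
  rw [D.isClosedEmbedding_emb.isInducing.nhds_eq_comap, eventually_comap] at hev
  have hcd : ∀ᶠ a in 𝓝 (D.emb s), ContDiffAt ℝ (n + 1 : ℕ) (ψ ∘ Λ) a :=
    hQ.eventually (by simp)
  obtain ⟨ε, hε, h⟩ := Metric.nhds_basis_closedBall.eventually_iff.1 (hball.and (hcd.and hev))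
  refine ⟨ψ ∘ Λ, ε, hε, fun a ha => ⟨(h ha).2.1.of_le (mod_cast Nat.le_succ n), (h ha).1⟩,
    fun t ht => (h ht).2.2 t rfl⟩

/-- Functions on the manifold extend to the ambient space with control of the derivatives. -/
theorem exists_extension [IsManifold (𝓡 d) ∞ M] [CompactSpace M] [Nonempty M] (D : NormData d M) {k : ℕ}
    (hk : 1 ≤ k) {α : ℝ} (hα : 0 ≤ α) (hα' : α ≤ 1) :
    ∃ C : ℝ, 1 ≤ C ∧ ∀ (u : M → EuclideanSpace ℝ (Fin D.dim)) (B : ℝ), D.MapBound k α u B →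
      ∃ g : EuclideanSpace ℝ (Fin D.dim) → EuclideanSpace ℝ (Fin D.dim),
        (∀ t, g (D.emb t) = u t) ∧ JetBound k α g univ (C * B) := by
  classical
  -- Order `k + 1` makes the ambient charts `C^{k,1}` on compact balls, hence `C^{k+α}` with bounds
  -- that do not depend on `u`.
  choose c hc Q ε hε hQ hQe using D.exists_ambient_chart (k + 1)
  have hcomp : IsCompact (range D.emb) := isCompact_range D.emb_smooth.continuous
  obtain ⟨I, hI⟩ := hcomp.elim_finite_subcover (fun s : M => Metric.ball (D.emb s) (ε s))
    (fun s => Metric.isOpen_ball) (by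
      rintro _ ⟨t, rfl⟩
      exact mem_iUnion.2 ⟨t, Metric.mem_ball_self (hε t)⟩)
  obtain ⟨χ, hχ⟩ := SmoothPartitionOfUnity.exists_isSubordinate (𝓡 D.dim)
    (D.isClosedEmbedding_emb.isClosed_range) (fun s : I => Metric.ball (D.emb s) (ε s))
    (fun s => Metric.isOpen_ball) (by
      intro a ha
      obtain ⟨s, hs, has⟩ := mem_iUnion₂.1 (hI ha)
      exact mem_iUnion.2 ⟨⟨s, hs⟩, has⟩)
  have hsub : ∀ s : I, Metric.ball (D.emb s) (ε s) ⊆ Metric.closedBall (D.emb s) (ε s) :=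
    fun s => Metric.ball_subset_closedBall
  have h1 : ∀ s : I, ∃ L : ℝ, 1 ≤ L ∧ JetBound k α (Q s) (Metric.ball (D.emb s) (ε s)) L := by
    intro s
    obtain ⟨L, hL⟩ := JetBound.exists_of_isCompact (k := k) (isCompact_closedBall (D.emb s) (ε s))
      (convex_closedBall _ _) (fun a ha => mod_cast (hQ s a ha).1) hα hα'
    exact ⟨max 1 L, le_max_left _ _, (hL.mono_set (hsub s)).mono (le_max_right _ _)⟩
  choose L hL1 hL using h1
  have h2 : ∀ s : I, ∃ A : ℝ, 0 ≤ A ∧ JetBound k α (χ s) (Metric.ball (D.emb s) (ε s)) A := by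
    intro s
    obtain ⟨A, hA⟩ := JetBound.exists_of_isCompact (k := k) (f := χ s)
      (isCompact_closedBall (D.emb s) (ε s))
      (convex_closedBall _ _) (fun a ha => ((χ s).contMDiff.contDiff.contDiffAt).of_le
        (by exact_mod_cast le_top)) hα hα'
    exact ⟨max 0 A, le_max_left _ _, (hA.mono_set (hsub s)).mono (le_max_right _ _)⟩
  choose A hA0 hA using h2
  have h3 : ∀ s : I, ∃ C : ℝ, 1 ≤ C ∧
      ∀ (f : EuclideanSpace ℝ (Fin D.dim) → EuclideanSpace ℝ (Fin D.dim)) (B : ℝ),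
        0 ≤ B → (∀ x ∉ tsupport (χ s), f x = 0) →
        JetBound k α f (Metric.ball (D.emb s) (ε s)) B → JetBound k α f univ (C * B) := by
    intro s
    refine JetBound.exists_extend_zero ?_ Metric.isOpen_ball (hχ s) hα
    exact (isCompact_closedBall (D.emb s) (ε s)).of_isClosed_subset (isClosed_tsupport _)
      ((hχ s).trans (hsub s))
  choose Z hZ1 hZ using h3
  set W : I → ℝ := fun s =>
    Z s * (2 ^ (k + 2) * (A s * (faaDiBrunoTerms k * (2 * k + 2) * L s ^ (k + 1)))) with hW
  have hW0 : ∀ s, 0 ≤ W s := fun s => by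
    have := hA0 s
    have := (zero_le_one.trans (hZ1 s))
    have := (zero_le_one.trans (hL1 s))
    have := faaDiBrunoTerms_nonneg k
    positivity
  refine ⟨1 + ∑ s, W s, le_add_of_nonneg_right (Finset.sum_nonneg fun s _ => hW0 s),
    fun u B hu => ?_⟩
  -- The local extensions `u ∘ chart⁻¹ ∘ Q s` are glued by a partition of unity. It sums to `1` only
  -- on the embedded manifold, which is where the values must agree with `u`.
  refine ⟨fun a => ∑ s : I, χ s a • u ((extChartAt (𝓡 d) (c s)).symm (Q s a)), fun t => ?_, ?_⟩
  · have hsum : ∑ s : I, χ s (D.emb t) = 1 := by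
      rw [← finsum_eq_sum_of_fintype]; exact χ.sum_eq_one (mem_range_self t)
    rw [← one_smul ℝ (u t), ← hsum, Finset.sum_smul]
    refine Finset.sum_congr rfl fun s _ => ?_
    by_cases hs : χ s (D.emb t) = 0
    · rw [hs, zero_smul, zero_smul]
    · have hmem : D.emb t ∈ Metric.closedBall (D.emb s) (ε s) :=
        hsub s (hχ s (subset_tsupport _ hs))
      obtain ⟨hsrc, hq⟩ := hQe s t hmem
      rw [hq, PartialEquiv.left_inv _ hsrc]
  · have hB : 0 ≤ B := hu.nonneg
    have key : ∀ s ∈ Finset.univ, JetBound k α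
        (fun a => χ s a • u ((extChartAt (𝓡 d) (c s)).symm (Q s a))) univ (W s * B) := by
      intro s _
      have e1 := (hu (c s) (hc s)).comp (hL s) (D.convex_chartBall _) (convex_ball _ _)
        (fun a ha => (hQ s a (hsub s ha)).2) hk hα hα' (hL1 s)
      have e2 := (hA s).smul e1 (convex_ball _ _) hα hα'
      have e3 := hZ s _ _ (e2.nonneg ⟨D.emb s, Metric.mem_ball_self (hε s)⟩) (fun a ha => by
        rw [image_eq_zero_of_notMem_tsupport ha, zero_smul]) e2
      refine e3.mono (le_of_eq ?_)
      rw [hW]; ring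
    refine (JetBound.sum Finset.univ key).mono ?_
    rw [← Finset.sum_mul, add_mul, one_mul]
    exact le_add_of_nonneg_left hB

end NormData

/-! ## Estimates for compositions of maps of the manifold -/

namespace NormData

variable {d : ℕ} {M : Type v} [TopologicalSpace M] [ChartedSpace (EuclideanSpace ℝ (Fin d)) M]

theorem exists_comp_bound [IsManifold (𝓡 d) ∞ M] [CompactSpace M] [Nonempty M] (D : NormData d M)
    {k : ℕ} (hk : 1 ≤ k) {α : ℝ} (hα : 0 ≤ α) (hα' : α ≤ 1) :
    ∃ C : ℝ, 1 ≤ C ∧ ∀ (u : M → EuclideanSpace ℝ (Fin D.dim)) (F : M → M) (B L : ℝ), 1 ≤ L →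
      D.MapBound k α u B → D.MapBound k α (fun t => D.emb (F t)) L →
      D.MapBound k α (fun t => u (F t)) (C * (B * L ^ (k + 1))) := by
  obtain ⟨C, hC, h⟩ := D.exists_extension hk hα hα'
  refine ⟨1 + faaDiBrunoTerms k * (2 * k + 2) * C, ?_, fun u F B L hL hu hF c hc => ?_⟩
  · have := faaDiBrunoTerms_nonneg k
    have : 0 ≤ faaDiBrunoTerms k * (2 * k + 2) * C := by positivity
    linarith
  · obtain ⟨g, hg, hgB⟩ := h u B hu
    have hB : 0 ≤ B := hu.nonneg
    have := hgB.comp (hF c hc) convex_univ (D.convex_chartBall c) (mapsTo_univ _ _) hk hα hα' hL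
    have e : g ∘ (fun t => D.emb (F t)) ∘ (extChartAt (𝓡 d) c).symm =
        (fun t => u (F t)) ∘ (extChartAt (𝓡 d) c).symm := by
      ext1 x; exact hg _
    rw [e] at this
    refine this.mono ?_
    have : 0 ≤ B * L ^ (k + 1) := by positivity
    calc _ = faaDiBrunoTerms k * (2 * k + 2) * C * (B * L ^ (k + 1)) := by ring
      _ ≤ _ := by gcongr; linarith

theorem exists_comp_sub_bound [IsManifold (𝓡 d) ∞ M] [CompactSpace M] [Nonempty M]
    (D : NormData d M) {k : ℕ} (hk : 1 ≤ k) {γ : ℝ} (hγ : 0 ≤ γ) (hγ' : γ ≤ 1) :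
    ∃ C : ℝ, 1 ≤ C ∧ ∀ (u : M → EuclideanSpace ℝ (Fin D.dim)) (F F' : M → M) (B L δ : ℝ), 1 ≤ L →
      δ ≤ 2 * L → D.MapBound k γ u B → D.MapBound k γ (fun t => D.emb (F t)) L →
      D.MapBound k γ (fun t => D.emb (F' t)) L →
      D.MapBound k 0 (fun t => D.emb (F t) - D.emb (F' t)) δ →
      D.MapBound k 0 (fun t => u (F t) - u (F' t)) (C * (B * L ^ (k + 1) * δ ^ γ)) := by
  obtain ⟨C, hC, h⟩ := D.exists_extension hk hγ hγ'
  refine ⟨1 + 2 * (faaDiBrunoTerms k * (2 * k + 2) * C), ?_,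
    fun u F F' B L δ hL hδ hu hF hF' hFF c hc => ?_⟩
  · have := faaDiBrunoTerms_nonneg k
    have : 0 ≤ faaDiBrunoTerms k * (2 * k + 2) * C := by positivity
    linarith
  · obtain ⟨g, hg, hgB⟩ := h u B hu
    have hB : 0 ≤ B := hu.nonneg
    have hδ0 : 0 ≤ δ := hFF.nonneg
    have := hgB.comp_sub_comp (hF c hc) (hF' c hc) (hFF c hc) convex_univ (mapsTo_univ _ _)
      (mapsTo_univ _ _) hγ hγ' hL hδ
    have e : (fun x => g (((fun t => D.emb (F t)) ∘ (extChartAt (𝓡 d) c).symm) x) -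
        g (((fun t => D.emb (F' t)) ∘ (extChartAt (𝓡 d) c).symm) x)) =
        (fun t => u (F t) - u (F' t)) ∘ (extChartAt (𝓡 d) c).symm := by
      ext1 x
      simp only [Function.comp_apply, hg]
    rw [e] at this
    refine this.mono ?_
    have : 0 ≤ B * L ^ (k + 1) * δ ^ γ := by positivity
    calc _ = 2 * (faaDiBrunoTerms k * (2 * k + 2) * C) * (B * L ^ (k + 1) * δ ^ γ) := by ring
      _ ≤ _ := by gcongr; linarith

/-- Chart expressions are controlled only on balls, whereas `JetBound.tsum` needs functions
controlled on a whole space. The terms are therefore extended to `ℝ^N`, summed there, and restricted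
by composing with the embedding. -/
theorem exists_tsum_bound [IsManifold (𝓡 d) ∞ M] [CompactSpace M] [Nonempty M] (D : NormData d M)
    {k : ℕ} (hk : 1 ≤ k) {α : ℝ} (hα : 0 ≤ α) (hα' : α ≤ 1) :
    ∃ C : ℝ, 1 ≤ C ∧ ∀ (u : ℕ → M → EuclideanSpace ℝ (Fin D.dim)) (b : ℕ → ℝ),
      (∀ n, D.MapBound k α (u n) (b n)) → Summable b →
      D.MapBound k α (fun t => ∑' n, u n t) (C * ∑' n, b n) := by
  obtain ⟨C, hC, h⟩ := D.exists_extension hk hα hα'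
  obtain ⟨B₀, hB₀⟩ := D.exists_mapBound_emb k hα hα'
  have hT := faaDiBrunoTerms_nonneg k
  set L := max 1 B₀
  have hL : 1 ≤ L := le_max_left _ _
  set C' := faaDiBrunoTerms k * (2 * k + 2) * (C * L ^ (k + 1)) with hC'
  have hC'0 : 0 ≤ C' := by positivity
  refine ⟨1 + C', by linarith, fun u b hu hb c hc => ?_⟩
  choose g hg hgB using fun n => h (u n) (b n) (hu n)
  have hb0 : 0 ≤ ∑' n, b n := tsum_nonneg fun n => (hu n).nonneg
  have h1 := JetBound.tsum hgB (hb.mul_left C)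
  have h2 := h1.comp ((hB₀ c hc).mono (le_max_right 1 B₀)) convex_univ (D.convex_chartBall c)
    (mapsTo_univ _ _) hk hα hα' hL
  have e : (fun x => ∑' n, g n x) ∘ D.emb ∘ (extChartAt (𝓡 d) c).symm =
      (fun t => ∑' n, u n t) ∘ (extChartAt (𝓡 d) c).symm := by
    ext1 x
    simp only [Function.comp_apply, hg]
  rw [e] at h2
  refine h2.mono ?_
  rw [tsum_mul_left]
  calc _ = C' * ∑' n, b n := by rw [hC']; ring
    _ ≤ _ := by gcongr; linarith

theorem MapBound.interpolate {D : NormData d M} {k : ℕ} {α γ a b : ℝ}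
    {u : M → EuclideanSpace ℝ (Fin D.dim)} (ha : D.MapBound k 0 u a) (hb : D.MapBound k γ u b)
    (hγ : 0 < γ) (hα : 0 ≤ α) (hαγ : α ≤ γ) (hab : a ≤ b) :
    D.MapBound k α u (a ^ (1 - α / γ) * b ^ (α / γ)) :=
  fun c hc => (ha c hc).interpolate (hb c hc) hγ hα hαγ hab

theorem MapBound.to_zero {D : NormData d M} {k : ℕ} {α b : ℝ}
    {u : M → EuclideanSpace ℝ (Fin D.dim)} (h : D.MapBound k α u b) : D.MapBound k 0 u (2 * b) :=
  fun c hc => JetBound.of_norm_le (h c hc).contDiffAt (h c hc).norm_le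

theorem MapBound.of_exponent_le {D : NormData d M} {k : ℕ} {α γ b : ℝ} [Nonempty M]
    {u : M → EuclideanSpace ℝ (Fin D.dim)} (h : D.MapBound k γ u b)
    (hγ : 0 < γ) (hα : 0 ≤ α) (hαγ : α ≤ γ) : D.MapBound k α u (2 * b) := by
  have hb := h.nonneg
  have := h.to_zero.interpolate (h.mono (by linarith : b ≤ 2 * b)) hγ hα hαγ le_rfl
  refine this.mono (le_of_eq ?_)
  rw [← Real.rpow_add_of_nonneg (by positivity), sub_add_cancel, Real.rpow_one]
  · rw [sub_nonneg, div_le_one hγ]; exact hαγ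
  · positivity

/-! ### Comparison with the extended norms -/

/-- Smoothness is a separate assumption because `iteratedFDeriv` takes default values where a map is
not differentiable. The factor `2` is the oscillation when `α = 0`. -/
theorem mapBound_of_vecNorm_le [IsManifold (𝓡 d) ∞ M] (D : NormData d M) {k : ℕ} {α B : ℝ}
    {u : M → EuclideanSpace ℝ (Fin D.dim)} (hu : ContMDiff (𝓡 d) (𝓡 D.dim) k u)
    (hB : 0 ≤ B) (h : D.vecNorm k α u ≤ ENNReal.ofReal B) : D.MapBound k α u (2 * B) := by
  have hsup : ∀ t, ‖u t‖ ≤ B := fun t => by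
    have : ‖u t‖ₑ ≤ ENNReal.ofReal B := (le_iSup (fun t => ‖u t‖ₑ) t).trans (le_self_add.trans h)
    rwa [← ofReal_norm, ENNReal.ofReal_le_ofReal_iff hB] at this
  have hder : D.derivNorm k α u ≤ ENNReal.ofReal B := le_add_self.trans h
  have hn : ∀ c ∈ D.centers, ∀ j ≤ k, ∀ x ∈ D.chartBall c, ‖D.chartDeriv u j c x‖ ≤ B := by
    intro c hc j hj x hx
    rcases Nat.eq_zero_or_pos j with rfl | hj0
    · rw [chartDeriv, norm_iteratedFDeriv_zero]
      exact hsup _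
    · have h1 : ‖D.chartDeriv u j c x‖ₑ ≤ ENNReal.ofReal B := by
        refine le_trans ?_ (le_self_add.trans hder)
        refine le_iSup₂_of_le j (Finset.mem_Icc.2 ⟨hj0, hj⟩) ?_
        exact le_iSup₂_of_le c hc (le_iSup₂_of_le x hx le_rfl)
      rwa [← ofReal_norm, ENNReal.ofReal_le_ofReal_iff hB] at h1
  intro c hc
  refine ⟨fun x hx => mod_cast D.contDiffAt_comp_symm (n := k) hu hc hx, fun j hj x hx => ?_,
    fun x hx y hy => ?_⟩
  · have : ‖D.chartDeriv u j c x‖ ≤ 2 * B := (hn c hc j hj x hx).trans (by linarith)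
    exact this
  · by_cases h0 : α = 0
    · rw [h0, Real.rpow_zero, mul_one, two_mul]
      exact norm_sub_le_of_le (hn c hc k le_rfl x hx) (hn c hc k le_rfl y hy)
    · rcases eq_or_ne x y with rfl | hxy
      · rw [sub_self, norm_zero]; positivity
      · have h1 : ‖D.chartDeriv u k c x - D.chartDeriv u k c y‖ₑ / edist x y ^ α
            ≤ ENNReal.ofReal B := by
          refine le_trans ?_ (le_add_self.trans hder)
          rw [if_neg h0]
          refine le_iSup₂_of_le c hc (le_iSup₂_of_le x hx (le_iSup₂_of_le y hy ?_))
          exact le_iSup_of_le hxy le_rfl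
        have hpos : 0 < ‖x - y‖ := norm_sub_pos_iff.2 hxy
        rw [edist_eq_enorm_sub, ← ofReal_norm, ← ofReal_norm,
          ENNReal.ofReal_rpow_of_pos hpos, ← ENNReal.ofReal_div_of_pos (by positivity),
          ENNReal.ofReal_le_ofReal_iff hB, div_le_iff₀ (by positivity)] at h1
        refine h1.trans ?_
        have : 0 ≤ ‖x - y‖ ^ α := by positivity
        nlinarith

theorem MapBound.vecNorm_le {D : NormData d M} {k : ℕ} {α B : ℝ}
    {u : M → EuclideanSpace ℝ (Fin D.dim)} (h : D.MapBound k α u B) (hB : 0 ≤ B) :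
    D.vecNorm k α u ≤ ENNReal.ofReal (3 * B) := by
  have e : (3 : ℝ) * B = B + (B + B) := by ring
  rw [e, ENNReal.ofReal_add hB (by positivity), ENNReal.ofReal_add hB hB]
  refine add_le_add (iSup_le fun t => ?_) (add_le_add ?_ ?_)
  · rw [← ofReal_norm]
    exact ENNReal.ofReal_le_ofReal (h.norm_apply_le t)
  · refine iSup₂_le fun j hj => iSup₂_le fun c hc => iSup₂_le fun x hx => ?_
    rw [← ofReal_norm]
    exact ENNReal.ofReal_le_ofReal ((h c hc).norm_le j (Finset.mem_Icc.1 hj).2 x hx)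
  · split_ifs with h0
    · exact zero_le
    · refine iSup₂_le fun c hc => iSup₂_le fun x hx => iSup₂_le fun y hy => iSup_le fun hxy => ?_
      have hpos : 0 < ‖x - y‖ := norm_sub_pos_iff.2 hxy
      rw [edist_eq_enorm_sub, ← ofReal_norm, ← ofReal_norm,
        ENNReal.ofReal_rpow_of_pos hpos, ← ENNReal.ofReal_div_of_pos (by positivity)]
      refine ENNReal.ofReal_le_ofReal ?_
      rw [div_le_iff₀ (by positivity)]
      exact (h c hc).holder x hx y hy

/-- A continuous map of the manifold is `C^k` if its composition with the embedding is. -/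
theorem contMDiff_of_emb_comp [IsManifold (𝓡 d) ∞ M] [CompactSpace M] (D : NormData d M) {k : ℕ}
    {g : M → M} (hg : Continuous g)
    (h : ContMDiff (𝓡 d) (𝓡 D.dim) k (fun t => D.emb (g t))) : ContMDiff (𝓡 d) (𝓡 d) k g := by
  intro t
  obtain ⟨c, hc, Q, ε, hε, hQ, hQe⟩ := D.exists_ambient_chart k (g t)
  have h1 : ContMDiffAt (𝓡 d) (𝓡 d) k (fun t => Q (D.emb (g t))) t :=
    ((hQ _ (Metric.mem_closedBall_self hε.le)).1.contMDiffAt).comp t (h t)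
  have h2 : ContMDiffAt (𝓡 d) (𝓡 d) k (extChartAt (𝓡 d) c).symm (Q (D.emb (g t))) :=
    ((contMDiffOn_extChartAt_symm (n := ∞) c).contMDiffAt
      ((isOpen_extChartAt_target c).mem_nhds (D.closedBall_subset c hc
        (hQ _ (Metric.mem_closedBall_self hε.le)).2))).of_le (mod_cast le_top)
  refine (h2.comp t h1).congr_of_eventuallyEq ?_
  have hev : ∀ᶠ t' in 𝓝 t, D.emb (g t') ∈ Metric.closedBall (D.emb (g t)) ε :=
    (D.emb_smooth.continuous.comp hg).continuousAt.eventually_mem (Metric.closedBall_mem_nhds _ hε)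
  filter_upwards [hev] with t' ht'
  obtain ⟨hs, hq⟩ := hQe _ ht'
  rw [Function.comp_apply, hq, PartialEquiv.left_inv _ hs]

theorem diffDist_le_of_mapBound (D : NormData d M) {k : ℕ} {α B : ℝ} {g h : M ≃ₜ M} (hB : 0 ≤ B)
    (h₁ : D.MapBound k α (fun t => D.emb (g t) - D.emb (h t)) B)
    (h₂ : D.MapBound k α (fun t => D.emb (g.symm t) - D.emb (h.symm t)) B) :
    D.diffDist k α g h ≤ ENNReal.ofReal (6 * B) := by
  have e : (6 : ℝ) * B = 3 * B + 3 * B := by ring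
  rw [e, ENNReal.ofReal_add (by positivity) (by positivity)]
  exact add_le_add (h₁.vecNorm_le hB) (h₂.vecNorm_le hB)

theorem mapBound_of_diffDist_le [IsManifold (𝓡 d) ∞ M] (D : NormData d M) {k : ℕ} {α B : ℝ}
    {g h : M ≃ₜ M} (hg : D.MemDiff k α g) (hh : D.MemDiff k α h) (hB : 0 ≤ B)
    (hd : D.diffDist k α g h ≤ ENNReal.ofReal B) :
    D.MapBound k α (fun t => D.emb (g t) - D.emb (h t)) (2 * B) ∧
      D.MapBound k α (fun t => D.emb (g.symm t) - D.emb (h.symm t)) (2 * B) := by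
  have he : ContMDiff (𝓡 d) (𝓡 D.dim) k D.emb := D.emb_smooth.of_le (mod_cast le_top)
  exact ⟨D.mapBound_of_vecNorm_le ((he.comp hg.contMDiff).sub (he.comp hh.contMDiff)) hB
      (le_self_add.trans hd),
    D.mapBound_of_vecNorm_le ((he.comp hg.contMDiff_symm).sub (he.comp hh.contMDiff_symm)) hB
      (le_add_self.trans hd)⟩

/-- The `C^0` part of `size` measures displacement, so the sup norm of `emb ∘ g` is bounded through
the radius `R` of the embedded manifold instead. -/
theorem mapBound_of_size_le [IsManifold (𝓡 d) ∞ M] (D : NormData d M) {k : ℕ} {α S R : ℝ}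
    {g : M ≃ₜ M} (hg : ContMDiff (𝓡 d) (𝓡 d) k g)
    (hg' : ContMDiff (𝓡 d) (𝓡 d) k g.symm) (hS : 0 ≤ S) (hR0 : 0 ≤ R)
    (hR : ∀ t, ‖D.emb t‖ ≤ R) (h : D.size k α g ≤ ENNReal.ofReal S) :
    D.MapBound k α (fun t => D.emb (g t)) (2 * (R + S)) ∧
      D.MapBound k α (fun t => D.emb (g.symm t)) (2 * (R + S)) := by
  have he : ContMDiff (𝓡 d) (𝓡 D.dim) k D.emb := D.emb_smooth.of_le (mod_cast le_top)
  have key : ∀ g : M → M, D.mapNorm k α g ≤ ENNReal.ofReal S →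
      D.vecNorm k α (fun t => D.emb (g t)) ≤ ENNReal.ofReal (R + S) := by
    intro g hgS
    rw [ENNReal.ofReal_add hR0 hS]
    refine add_le_add (iSup_le fun t => ?_) (le_add_self.trans hgS)
    rw [← ofReal_norm]
    exact ENNReal.ofReal_le_ofReal (hR _)
  exact ⟨D.mapBound_of_vecNorm_le (he.comp hg) (by positivity) (key _ (le_self_add.trans h)),
    D.mapBound_of_vecNorm_le (he.comp hg') (by positivity) (key _ (le_add_self.trans h))⟩

theorem memDiff_of_mapBound [IsManifold (𝓡 d) ∞ M] [CompactSpace M] (D : NormData d M) {k : ℕ}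
    {α B R : ℝ} {g : M ≃ₜ M} (hB : 0 ≤ B) (hR : ∀ t, ‖D.emb t‖ ≤ R)
    (h₁ : D.MapBound k α (fun t => D.emb (g t)) B)
    (h₂ : D.MapBound k α (fun t => D.emb (g.symm t)) B) : D.MemDiff k α g := by
  have key : ∀ g : M → M, D.MapBound k α (fun t => D.emb (g t)) B → D.mapNorm k α g < ⊤ := by
    intro g hg
    have h1 : (⨆ t : M, edist (D.emb (g t)) (D.emb t)) ≤ ENNReal.ofReal (R + R) :=
      iSup_le fun t => by
        rw [edist_eq_enorm_sub, ← ofReal_norm]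
        exact ENNReal.ofReal_le_ofReal (norm_sub_le_of_le (hR _) (hR _))
    have h2 : D.derivNorm k α (D.emb ∘ g) ≤ ENNReal.ofReal (3 * B) :=
      le_add_self.trans (hg.vecNorm_le hB)
    exact (add_le_add h1 h2).trans_lt
      (ENNReal.add_lt_top.2 ⟨ENNReal.ofReal_lt_top, ENNReal.ofReal_lt_top⟩)
  exact ⟨D.contMDiff_of_emb_comp g.continuous h₁.contMDiff,
    D.contMDiff_of_emb_comp g.symm.continuous h₂.contMDiff,
    ENNReal.add_lt_top.2 ⟨key _ h₁, key _ h₂⟩⟩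

end NormData

/-! ## Sequences of homeomorphisms that converge in the `C^r` topology -/

namespace NormData

variable {d : ℕ} {M : Type v} [TopologicalSpace M] [ChartedSpace (EuclideanSpace ℝ (Fin d)) M]

/-- The limit is the sum of a telescoping series. `H` is fixed before the majorant `b` is chosen, so
one limit inherits the tail estimate of every admissible majorant. -/
theorem exists_limit_homeomorph [IsManifold (𝓡 d) ∞ M] [CompactSpace M] [Nonempty M]
    (D : NormData d M) {k : ℕ} (hk : 1 ≤ k) {α : ℝ} (hα : 0 ≤ α) (hα' : α ≤ 1) :
    ∃ C : ℝ, 1 ≤ C ∧ ∀ (h : ℕ → M ≃ₜ M) (b₀ : ℕ → ℝ),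
      (∀ n, D.MapBound k α (fun t => D.emb (h (n + 1) t) - D.emb (h n t)) (b₀ n)) →
      (∀ n, D.MapBound k α (fun t => D.emb ((h (n + 1)).symm t) - D.emb ((h n).symm t)) (b₀ n)) →
      Summable b₀ →
      ∃ H : M ≃ₜ M, ∀ b : ℕ → ℝ,
        (∀ n, D.MapBound k α (fun t => D.emb (h (n + 1) t) - D.emb (h n t)) (b n)) →
        (∀ n, D.MapBound k α (fun t => D.emb ((h (n + 1)).symm t) - D.emb ((h n).symm t)) (b n)) →
        Summable b → ∀ n,
        D.MapBound k α (fun t => D.emb (H t) - D.emb (h n t)) (C * ∑' m, b (n + m)) ∧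
        D.MapBound k α (fun t => D.emb (H.symm t) - D.emb ((h n).symm t))
          (C * ∑' m, b (n + m)) := by
  obtain ⟨C, hC, hsum⟩ := D.exists_tsum_bound hk hα hα'
  refine ⟨C, hC, fun h b₀ hb₁ hb₂ hb₀ => ?_⟩
  have hcl := D.isClosedEmbedding_emb
  have shift : ∀ {b : ℕ → ℝ}, Summable b → ∀ n, Summable fun m => b (n + m) := fun hb n => by
    simpa only [add_comm] using (summable_nat_add_iff n).2 hb
  -- the limit of one sequence of continuous maps
  have one : ∀ g : ℕ → M → M, (∀ n, Continuous (g n)) →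
      (∀ n, D.MapBound k α (fun t => D.emb (g (n + 1) t) - D.emb (g n t)) (b₀ n)) →
      ∃ G : M → M, Continuous G ∧ ∀ b : ℕ → ℝ,
        (∀ n, D.MapBound k α (fun t => D.emb (g (n + 1) t) - D.emb (g n t)) (b n)) →
        Summable b → ∀ n,
        D.MapBound k α (fun t => D.emb (G t) - D.emb (g n t)) (C * ∑' m, b (n + m)) := by
    intro g hg hgb
    have hsm : ∀ n t, Summable fun m => D.emb (g (n + m + 1) t) - D.emb (g (n + m) t) :=
      fun n t => .of_norm_bounded (shift hb₀ n) fun m => (hgb (n + m)).norm_apply_le t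
    have htel : ∀ t, Tendsto (fun n => D.emb (g n t)) atTop
        (𝓝 (D.emb (g 0 t) + ∑' m, (D.emb (g (0 + m + 1) t) - D.emb (g (0 + m) t)))) := by
      intro t
      have h1 := (hsm 0 t).hasSum.tendsto_sum_nat
      simp only [zero_add] at h1 ⊢
      have h2 : ∀ n, ∑ i ∈ Finset.range n, (D.emb (g (i + 1) t) - D.emb (g i t)) =
          D.emb (g n t) - D.emb (g 0 t) := fun n => Finset.sum_range_sub (fun n => D.emb (g n t)) n
      simp only [h2] at h1
      simpa using h1.const_add (D.emb (g 0 t))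
    -- The limit is formed in `ℝ^N`; it stays on the manifold because the image of `emb` is closed.
    have hmem : ∀ t, ∃ s, D.emb s =
        D.emb (g 0 t) + ∑' m, (D.emb (g (0 + m + 1) t) - D.emb (g (0 + m) t)) := fun t =>
      hcl.isClosed_range.mem_of_tendsto (htel t) (Eventually.of_forall fun n => mem_range_self _)
    choose G hG using hmem
    have hval : ∀ n t, D.emb (G t) - D.emb (g n t) =
        ∑' m, (D.emb (g (n + m + 1) t) - D.emb (g (n + m) t)) := by
      intro n t
      have h1 := (hsm n t).hasSum.tendsto_sum_nat
      have h2 : ∀ N, ∑ i ∈ Finset.range N, (D.emb (g (n + i + 1) t) - D.emb (g (n + i) t)) =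
          D.emb (g (n + N) t) - D.emb (g n t) := fun N =>
        Finset.sum_range_sub (fun N => D.emb (g (n + N) t)) N
      simp only [h2] at h1
      have h3 : Tendsto (fun N => D.emb (g (n + N) t)) atTop (𝓝 (D.emb (G t))) := by
        rw [hG t]
        exact (htel t).comp (tendsto_add_atTop_nat n |>.congr fun N => add_comm _ _)
      exact tendsto_nhds_unique (h3.sub_const _) h1
    have hbd : ∀ b : ℕ → ℝ,
        (∀ n, D.MapBound k α (fun t => D.emb (g (n + 1) t) - D.emb (g n t)) (b n)) →
        Summable b → ∀ n,
        D.MapBound k α (fun t => D.emb (G t) - D.emb (g n t)) (C * ∑' m, b (n + m)) := by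
      intro b hb hbs n
      have := hsum (fun m t => D.emb (g (n + m + 1) t) - D.emb (g (n + m) t)) (fun m => b (n + m))
        (fun m => hb (n + m)) (shift hbs n)
      simpa only [← hval] using this
    refine ⟨G, ?_, hbd⟩
    have h1 : Continuous fun t => D.emb (G t) - D.emb (g 0 t) :=
      (hbd b₀ hgb hb₀ 0).contMDiff.continuous
    have h2 : Continuous fun t => D.emb (G t) := by
      have := h1.add (D.emb_smooth.continuous.comp (hg 0))
      refine this.congr fun t => ?_
      simp
    exact hcl.isInducing.continuous_iff.2 h2
  obtain ⟨G, hGc, hG⟩ := one (fun n => h n) (fun n => (h n).continuous) hb₁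
  obtain ⟨G', hGc', hG'⟩ := one (fun n => (h n).symm) (fun n => (h n).symm.continuous) hb₂
  have htail : Tendsto (fun n => C * ∑' m, b₀ (n + m)) atTop (𝓝 0) := by
    have := (tendsto_sum_nat_add b₀).const_mul C
    simpa only [mul_zero, add_comm] using this
  -- the two limits are inverse to each other
  have inv : ∀ (g g' : ℕ → M → M) (G G' : M → M), Continuous G → (∀ n t, g n (g' n t) = t) →
      (∀ n, D.MapBound k α (fun t => D.emb (G t) - D.emb (g n t)) (C * ∑' m, b₀ (n + m))) →
      (∀ n, D.MapBound k α (fun t => D.emb (G' t) - D.emb (g' n t)) (C * ∑' m, b₀ (n + m))) →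
      ∀ t, G (G' t) = t := by
    intro g g' G G' hGc hgg hG hG' t
    have h1 : Tendsto (fun n => D.emb (g' n t)) atTop (𝓝 (D.emb (G' t))) := by
      rw [tendsto_iff_norm_sub_tendsto_zero]
      refine squeeze_zero (fun _ => norm_nonneg _) (fun n => ?_) htail
      rw [norm_sub_rev]
      exact (hG' n).norm_apply_le t
    have h2 : Tendsto (fun n => g' n t) atTop (𝓝 (G' t)) := hcl.isInducing.tendsto_nhds_iff.2 h1
    have h3 : Tendsto (fun n => D.emb (G (g' n t))) atTop (𝓝 (D.emb (G (G' t)))) :=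
      ((D.emb_smooth.continuous.comp hGc).tendsto _).comp h2
    -- Evaluate the uniform bound on `G - g n` at the moving point `g' n t`, where `g n` returns
    -- `t`.
    have h4 : Tendsto (fun n => D.emb (G (g' n t))) atTop (𝓝 (D.emb t)) := by
      rw [tendsto_iff_norm_sub_tendsto_zero]
      refine squeeze_zero (fun _ => norm_nonneg _) (fun n => ?_) htail
      have := (hG n).norm_apply_le (g' n t)
      rwa [hgg] at this
    exact D.emb_injective (tendsto_nhds_unique h3 h4)
  let H : M ≃ₜ M :=
    { toFun := G
      invFun := G'
      left_inv := inv (fun n => (h n).symm) (fun n => h n) G' G hGc'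
        (fun n t => (h n).symm_apply_apply t) (hG' b₀ hb₂ hb₀) (hG b₀ hb₁ hb₀)
      right_inv := inv (fun n => h n) (fun n => (h n).symm) G G' hGc
        (fun n t => (h n).apply_symm_apply t) (hG b₀ hb₁ hb₀) (hG' b₀ hb₂ hb₀)
      continuous_toFun := hGc
      continuous_invFun := hGc' }
  exact ⟨H, fun b h₁ h₂ hb n => ⟨hG b h₁ hb n, hG' b h₂ hb n⟩⟩

end NormData

/-! ## Estimates along the orbits of a cocycle -/

/-- Bounds for a Hölder cocycle of diffeomorphisms and its iterates. -/
structure CocycleBound {X : Type u} [MetricSpace X] {d : ℕ} {M : Type v} [TopologicalSpace M]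
    [ChartedSpace (EuclideanSpace ℝ (Fin d)) M] (D : NormData d M) (k : ℕ) (γ : ℝ) (f : X → X)
    (A : X → M ≃ₜ M) (β c L η : ℝ) : Prop where
  one_le_const : 1 ≤ L
  one_le_rate : 1 ≤ η
  holderConst_nonneg : 0 ≤ c
  iter : ∀ n x, D.MapBound k γ (fun t => D.emb (cocycleIter f A n x t)) (L * η ^ n)
  iter_symm : ∀ n x, D.MapBound k γ (fun t => D.emb ((cocycleIter f A n x).symm t)) (L * η ^ n)
  holder : ∀ x y, D.MapBound k γ (fun t => D.emb (A x t) - D.emb (A y t)) (c * dist x y ^ β)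
  holder_symm : ∀ x y,
    D.MapBound k γ (fun t => D.emb ((A x).symm t) - D.emb ((A y).symm t)) (c * dist x y ^ β)

namespace CocycleBound

variable {X : Type u} [MetricSpace X] {d : ℕ} {M : Type v} [TopologicalSpace M]
  [ChartedSpace (EuclideanSpace ℝ (Fin d)) M] {D : NormData d M} {k : ℕ} {γ : ℝ} {f : X → X}
  {A : X → M ≃ₜ M} {β c L η : ℝ}

theorem generator (h : CocycleBound D k γ f A β c L η) (x : X) :
    D.MapBound k γ (fun t => D.emb (A x t)) (L * η) := by
  have := h.iter 1 x
  rwa [pow_one] at this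

theorem generator_symm (h : CocycleBound D k γ f A β c L η) (x : X) :
    D.MapBound k γ (fun t => D.emb ((A x).symm t)) (L * η) := by
  have := h.iter_symm 1 x
  rwa [pow_one] at this

theorem emb (h : CocycleBound D k γ f A β c L η) (x : X) : D.MapBound k γ D.emb L := by
  have := h.iter 0 x
  rwa [pow_zero, mul_one] at this

/-- With `a = P * t ^ γ` and `b = P * Q`, interpolation leaves the power `γ * (1 - α / γ) = γ - α`
of `t`, the origin of the exponent `ρ`. The result is linear in `P`, the factor that grows with `n`.
-/
theorem _root_.interpolation_bound_le {P Q t α : ℝ} (hP : 0 ≤ P) (hQ : 1 ≤ Q) (ht : 0 ≤ t)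
    (hα : 0 ≤ α) (hγ : 0 < γ) (hαγ : α < γ) :
    (P * t ^ γ) ^ (1 - α / γ) * (P * Q) ^ (α / γ) ≤ P * Q * t ^ (γ - α) := by
  have hs : 0 ≤ α / γ := by positivity
  have hs1 : α / γ ≤ 1 := (div_le_one hγ).2 hαγ.le
  have e : γ * (1 - α / γ) = γ - α := by field_simp
  have hP1 : P ^ (1 - α / γ) * P ^ (α / γ) = P := by
    rw [← Real.rpow_add_of_nonneg hP (by linarith) hs, sub_add_cancel, Real.rpow_one]
  have hQ1 : Q ^ (α / γ) ≤ Q := by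
    simpa using Real.rpow_le_rpow_of_exponent_le hQ hs1
  rw [Real.mul_rpow hP (by positivity), Real.mul_rpow hP (by linarith), ← Real.rpow_mul ht, e]
  calc _ = (P ^ (1 - α / γ) * P ^ (α / γ)) * Q ^ (α / γ) * t ^ (γ - α) := by ring
    _ ≤ _ := by rw [hP1]; gcongr

/-- The increment is `(G ∘ Δ - G) ∘ F` with `Δ` close to the identity. The factor `G` contributes `η
^ n` and composition with `F` contributes `(η ^ n) ^ (k + 1)`. -/
theorem exists_step_bound [IsManifold (𝓡 d) ∞ M] [CompactSpace M] [Nonempty M] (hk : 1 ≤ k)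
    (hγ : 0 < γ) (hγ' : γ ≤ 1) {α : ℝ} (hα : 0 ≤ α) (hαγ : α < γ) (hβ : 0 ≤ β)
    (h : CocycleBound D k γ f A β c L η) {R : ℝ}
    (hR : ∀ x y : X, dist x y ≤ R) (hR0 : 0 ≤ R) :
    ∃ C : ℝ, 0 ≤ C ∧ ∀ n x y, D.MapBound k α
      (fun t => D.emb (((cocycleIter f A (n + 1) y)⁻¹ * cocycleIter f A (n + 1) x) t) -
        D.emb (((cocycleIter f A n y)⁻¹ * cocycleIter f A n x) t))
      (C * (η ^ (k + 2)) ^ n * dist (f^[n] x) (f^[n] y) ^ (β * (γ - α))) := by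
  obtain ⟨C₁, hC₁, H₁⟩ := D.exists_comp_bound hk hγ.le hγ'
  obtain ⟨C₂, hC₂, H₂⟩ := D.exists_comp_sub_bound hk hγ.le hγ'
  obtain ⟨C₃, hC₃, H₃⟩ := D.exists_comp_bound hk hα (hαγ.le.trans hγ')
  have hL := h.one_le_const
  have hη := h.one_le_rate
  have hc := h.holderConst_nonneg
  set a := L * η with ha
  have ha1 : 1 ≤ a := one_le_mul_of_one_le_of_one_le hL hη
  set e₁ := C₁ * c * a ^ (k + 1) with he₁
  have he₁0 : 0 ≤ e₁ := by positivity
  -- `Λ` dominates the norms of the identity and of `Δ`, as well as `δ`; the last because distances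
  -- in the base are at most `R`.
  set Λ := L + C₁ * (a * a ^ (k + 1)) + e₁ * R ^ β with hΛ
  have hpow : 0 ≤ e₁ * R ^ β := by positivity
  have hpow' : 0 ≤ C₁ * (a * a ^ (k + 1)) := by positivity
  have hΛ1 : 1 ≤ Λ := by linarith
  set C' := 2 * C₁ + 2 * C₂ * Λ with hC'
  have hC'0 : 0 ≤ C' := by positivity
  refine ⟨C₃ * (C' * (L * Λ ^ (k + 1)) * (2 * Λ) * (2 * e₁) ^ (γ - α) * (2 * L) ^ (k + 1)), ?_,
    fun n x y => ?_⟩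
  · positivity
  set x' := f^[n] x
  set y' := f^[n] y
  set G := (cocycleIter f A n y).symm
  set F := cocycleIter f A n x
  set δ := e₁ * dist x' y' ^ β with hδ
  have hδ0 : 0 ≤ δ := by positivity
  have hδΛ : δ ≤ Λ := by
    have : δ ≤ e₁ * R ^ β := by rw [hδ]; gcongr; exact hR _ _
    linarith
  let Δ : M → M := fun t => (A y').symm (A x' t)
  -- `Δ - Id` is the difference of the inverses of `A y'` and `A x'`, evaluated after `A x'`.
  have b₁ : D.MapBound k γ (fun t => D.emb (Δ t) - D.emb t) δ := by
    have := H₁ (fun t => D.emb ((A y').symm t) - D.emb ((A x').symm t)) (A x') _ a ha1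
      (h.holder_symm y' x') (h.generator x')
    simp only [Homeomorph.symm_apply_apply] at this
    refine this.mono (le_of_eq ?_)
    rw [hδ, he₁, dist_comm]; ring
  have b₂ : D.MapBound k γ (fun t => D.emb (Δ t)) Λ :=
    (H₁ (fun t => D.emb ((A y').symm t)) (A x') a a ha1 (h.generator_symm y')
      (h.generator x')).mono (by linarith)
  have b₃ : D.MapBound k γ (fun t => D.emb t) Λ := (h.emb x).mono (by linarith)
  set Y := L * η ^ n * Λ ^ (k + 1) with hY
  have hY0 : 0 ≤ Y := by positivity
  have b₄ : D.MapBound k 0 (fun t => D.emb (G (Δ t)) - D.emb (G t))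
      (C' * Y * (2 * δ) ^ γ) := by
    refine (H₂ (fun t => D.emb (G t)) Δ id _ Λ (2 * δ) hΛ1 (by linarith) (h.iter_symm n y)
      b₂ b₃ b₁.to_zero).mono ?_
    rw [← mul_assoc]
    gcongr
    nlinarith
  have b₅ : D.MapBound k γ (fun t => D.emb (G (Δ t)) - D.emb (G t)) (C' * Y * (2 * Λ)) := by
    refine ((H₁ (fun t => D.emb (G t)) Δ _ Λ hΛ1 (h.iter_symm n y) b₂).sub
      (h.iter_symm n y)).mono ?_
    have : L * η ^ n ≤ Y := le_mul_of_one_le_right (by positivity) (one_le_pow₀ hΛ1)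
    have h1 : L * η ^ n ≤ C₁ * Y := this.trans (le_mul_of_one_le_left hY0 hC₁)
    have h2 : C₁ * Y + C₁ * Y ≤ C' * Y := by
      rw [hC']; nlinarith [mul_nonneg (mul_nonneg (zero_le_one.trans hC₂) (zero_le_one.trans hΛ1)) hY0]
    calc _ ≤ C' * Y := by linarith
      _ ≤ _ := le_mul_of_one_le_right (by positivity) (by linarith)
  have hab : C' * Y * (2 * δ) ^ γ ≤ C' * Y * (2 * Λ) := by
    gcongr
    calc (2 * δ) ^ γ ≤ (2 * Λ) ^ γ := by gcongr
      _ ≤ 2 * Λ := by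
        simpa using Real.rpow_le_rpow_of_exponent_le (by linarith : 1 ≤ 2 * Λ) hγ'
  have b₆ : D.MapBound k α (fun t => D.emb (G (Δ t)) - D.emb (G t))
      (C' * Y * (2 * Λ) * (2 * δ) ^ (γ - α)) :=
    (b₄.interpolate b₅ hγ hα hαγ.le hab).mono
      (interpolation_bound_le (by positivity) (by linarith) (by positivity) hα hγ hαγ)
  have hLn : 1 ≤ 2 * (L * η ^ n) := by
    have : 1 ≤ L * η ^ n := one_le_mul_of_one_le_of_one_le hL (one_le_pow₀ hη)
    linarith
  have b₇ := H₃ (fun t => D.emb (G (Δ t)) - D.emb (G t)) F _ _ hLn b₆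
    ((h.iter n x).of_exponent_le hγ hα hαγ.le)
  have hδρ : (2 * δ) ^ (γ - α) = (2 * e₁) ^ (γ - α) * dist x' y' ^ (β * (γ - α)) := by
    rw [hδ, ← mul_assoc, Real.mul_rpow (by positivity) (by positivity), ← Real.rpow_mul dist_nonneg]
  refine NormData.MapBound.mono b₇ ?_
  rw [hδρ, hY]
  refine le_of_eq ?_
  simp only [mul_pow, ← pow_mul]
  ring

end CocycleBound

/-- `lam` bounds the rate at which the orbits of `x` and `y` approach each other. -/
def ExpAsymptotic {X : Type u} [MetricSpace X] (f : X → X) (lam C₀ : ℝ) (x y : X) : Prop :=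
  0 ≤ C₀ ∧ ∀ n : ℕ, dist (f^[n] x) (f^[n] y) ≤ C₀ * lam ^ n

/-- The maps `(A^n_y)⁻¹ ∘ A^n_x` that approximate the stable holonomy. -/
def approxHolonomy {X : Type u} {M : Type v} [TopologicalSpace M] (f : X → X) (A : X → M ≃ₜ M)
    (n : ℕ) (x y : X) : M ≃ₜ M :=
  (cocycleIter f A n y)⁻¹ * cocycleIter f A n x

/-- `H` is the limit of the approximations of the holonomy in the `C^{k+α}` topology, with an
exponential rate of convergence. -/
def IsHolonomy {X : Type u} [MetricSpace X] {d : ℕ} {M : Type v} [TopologicalSpace M]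
    [ChartedSpace (EuclideanSpace ℝ (Fin d)) M] (D : NormData d M) (k : ℕ) (α : ℝ) (f : X → X)
    (A : X → M ≃ₜ M) (lam C τ θ : ℝ) (H : X → X → M ≃ₜ M) : Prop :=
  ∀ x y C₀, ExpAsymptotic f lam C₀ x y → ∀ n,
    D.MapBound k α (fun t => D.emb (H x y t) - D.emb (approxHolonomy f A n x y t))
      (C * C₀ ^ τ * θ ^ n) ∧
    D.MapBound k α (fun t => D.emb ((H x y).symm t) - D.emb ((approxHolonomy f A n x y).symm t))
      (C * C₀ ^ τ * θ ^ n)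

namespace CocycleBound

variable {X : Type u} [MetricSpace X] {d : ℕ} {M : Type v} [TopologicalSpace M]
  [ChartedSpace (EuclideanSpace ℝ (Fin d)) M] {D : NormData d M} {k : ℕ} {γ : ℝ} {f : X → X}
  {A : X → M ≃ₜ M} {β c L η : ℝ}

/-- The stable holonomies of a cocycle along exponentially asymptotic orbits. -/
theorem exists_holonomy [IsManifold (𝓡 d) ∞ M] [CompactSpace M] [Nonempty M] (hk : 1 ≤ k)
    (hγ : 0 < γ) (hγ' : γ ≤ 1) {α : ℝ} (hα : 0 ≤ α) (hαγ : α < γ) (hβ : 0 ≤ β)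
    (h : CocycleBound D k γ f A β c L η) {R : ℝ} (hR : ∀ x y : X, dist x y ≤ R) (hR0 : 0 ≤ R)
    {lam : ℝ} (hlam : 0 ≤ lam) (hθ : η ^ (k + 2) * lam ^ (β * (γ - α)) < 1) :
    ∃ (C : ℝ) (H : X → X → M ≃ₜ M), 0 ≤ C ∧
      IsHolonomy D k α f A lam C (β * (γ - α)) (η ^ (k + 2) * lam ^ (β * (γ - α))) H := by
  obtain ⟨C, hC, hstep⟩ := h.exists_step_bound hk hγ hγ' hα hαγ hβ hR hR0
  obtain ⟨C', hC', hlim⟩ := D.exists_limit_homeomorph hk hα (hαγ.le.trans hγ')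
  set τ := β * (γ - α) with hτ
  have hτ0 : 0 ≤ τ := mul_nonneg hβ (by linarith)
  set θ := η ^ (k + 2) * lam ^ τ with hθdef
  have hη := h.one_le_rate
  have hθ0 : 0 ≤ θ := by positivity
  have hb : ∀ x y C₀, ExpAsymptotic f lam C₀ x y → ∀ n,
      D.MapBound k α
        (fun t => D.emb (approxHolonomy f A (n + 1) x y t) -
          D.emb (approxHolonomy f A n x y t))
        (C * C₀ ^ τ * θ ^ n) := by
    intro x y C₀ ⟨hC₀, hd⟩ n
    refine (hstep n x y).mono ?_
    calc _ ≤ C * (η ^ (k + 2)) ^ n * (C₀ * lam ^ n) ^ τ := by gcongr; exact hd n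
      _ = _ := by
        have e : (lam ^ n) ^ τ = (lam ^ τ) ^ n := by
          rw [← Real.rpow_natCast, ← Real.rpow_natCast, ← Real.rpow_mul hlam,
            ← Real.rpow_mul hlam, mul_comm]
        rw [Real.mul_rpow hC₀ (by positivity), e, hθdef, mul_pow]
        ring
  -- The inverse of the approximation for `(x, y)` is the approximation for `(y, x)`, and the
  -- asymptotic condition is symmetric.
  have hb' : ∀ x y C₀, ExpAsymptotic f lam C₀ x y → ∀ n,
      D.MapBound k α
        (fun t => D.emb ((approxHolonomy f A (n + 1) x y).symm t) -
          D.emb ((approxHolonomy f A n x y).symm t))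
        (C * C₀ ^ τ * θ ^ n) := by
    intro x y C₀ ⟨hC₀, hd⟩ n
    exact hb y x C₀ ⟨hC₀, fun n => by rw [dist_comm]; exact hd n⟩ n
  have hsm : ∀ C₀, Summable fun n => C * C₀ ^ τ * θ ^ n := fun C₀ =>
    (summable_geometric_of_lt_one hθ0 hθ).mul_left _
  have hex : ∀ x y, ∃ H : M ≃ₜ M, ∀ C₀, ExpAsymptotic f lam C₀ x y → ∀ n,
      D.MapBound k α (fun t => D.emb (H t) -
          D.emb (approxHolonomy f A n x y t))
        (C' * ∑' m, C * C₀ ^ τ * θ ^ (n + m)) ∧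
      D.MapBound k α (fun t => D.emb (H.symm t) -
          D.emb ((approxHolonomy f A n x y).symm t))
        (C' * ∑' m, C * C₀ ^ τ * θ ^ (n + m)) := by
    intro x y
    by_cases hxy : ∃ C₀, ExpAsymptotic f lam C₀ x y
    · obtain ⟨C₀, hd⟩ := hxy
      obtain ⟨H, hH⟩ := hlim (fun n => approxHolonomy f A n x y) _
        (hb x y C₀ hd) (hb' x y C₀ hd) (hsm C₀)
      exact ⟨H, fun C₁ hd₁ => hH _ (hb x y C₁ hd₁) (hb' x y C₁ hd₁) (hsm C₁)⟩
    · exact ⟨1, fun C₀ hd => absurd ⟨C₀, hd⟩ hxy⟩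
  choose H hH using hex
  refine ⟨C' * C * (1 - θ)⁻¹, H, ?_, fun x y C₀ hd n => ?_⟩
  · have : 0 ≤ (1 - θ)⁻¹ := inv_nonneg.2 (by linarith)
    positivity
  · have e : C' * ∑' m, C * C₀ ^ τ * θ ^ (n + m) = C' * C * (1 - θ)⁻¹ * C₀ ^ τ * θ ^ n := by
      simp only [pow_add, ← mul_assoc]
      rw [tsum_mul_left, tsum_geometric_of_lt_one hθ0 hθ]
      ring
    rw [← e]
    exact hH x y C₀ hd n

end CocycleBound

/-! ## Continuity of the iterates -/

namespace NormData

variable {d : ℕ} {M : Type v} [TopologicalSpace M] [ChartedSpace (EuclideanSpace ℝ (Fin d)) M]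

/-- The maps `G p` converge to `G₀` in the `C^{k+α}` topology. -/
def TendstoMap (D : NormData d M) (k : ℕ) (α : ℝ) {P : Type*} (G : P → M → M) (l : Filter P)
    (G₀ : M → M) : Prop :=
  ∀ ε > 0, ∀ᶠ p in l, D.MapBound k α (fun t => D.emb (G p t) - D.emb (G₀ t)) ε

theorem TendstoMap.comp_tendsto {D : NormData d M} {k : ℕ} {α : ℝ} {P P' : Type*} {G : P → M → M}
    {l : Filter P} {G₀ : M → M} (h : D.TendstoMap k α G l G₀) {l' : Filter P'} {s : P' → P}
    (hs : Tendsto s l' l) : D.TendstoMap k α (fun p => G (s p)) l' G₀ :=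
  fun ε hε => hs.eventually (h ε hε)

/-- Split into `(G p - G₀) ∘ F p` and `G₀ ∘ F p - G₀ ∘ F₀`. The second term needs Hölder regularity
of `G₀` beyond the topology of convergence, hence `C^k` convergence together with `C^{k+γ}` bounds.
-/
theorem TendstoMap.comp [IsManifold (𝓡 d) ∞ M] [CompactSpace M] [Nonempty M] {D : NormData d M}
    {k : ℕ} (hk : 1 ≤ k) {γ : ℝ} (hγ : 0 < γ) (hγ' : γ ≤ 1) {P : Type*} {l : Filter P}
    {G F : P → M → M} {G₀ F₀ : M → M} {B L : ℝ} (hL : 1 ≤ L)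
    (hG : D.TendstoMap k 0 G l G₀) (hF : D.TendstoMap k 0 F l F₀)
    (hG₀ : D.MapBound k γ (fun t => D.emb (G₀ t)) B)
    (hFp : ∀ p, D.MapBound k γ (fun t => D.emb (F p t)) L)
    (hF₀ : D.MapBound k γ (fun t => D.emb (F₀ t)) L) :
    D.TendstoMap k 0 (fun p t => G p (F p t)) l (fun t => G₀ (F₀ t)) := by
  obtain ⟨C₁, hC₁, H₁⟩ := D.exists_comp_bound hk le_rfl zero_le_one
  obtain ⟨C₂, hC₂, H₂⟩ := D.exists_comp_sub_bound hk hγ.le hγ'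
  have hφ : Tendsto (fun e : ℝ => C₁ * (e * (2 * L) ^ (k + 1)) + C₂ * (B * L ^ (k + 1) * e ^ γ))
      (𝓝[>] 0) (𝓝 0) := by
    have hc : ContinuousAt (fun e : ℝ => C₁ * (e * (2 * L) ^ (k + 1)) +
        C₂ * (B * L ^ (k + 1) * e ^ γ)) 0 := by
      have := Real.continuousAt_rpow_const 0 γ (Or.inr hγ.le)
      fun_prop
    have := hc.tendsto.mono_left (nhdsWithin_le_nhds (s := Ioi 0))
    simpa [Real.zero_rpow hγ.ne'] using this
  intro ε hε
  have hsmall : ∀ᶠ e : ℝ in 𝓝[>] 0, e ≤ 2 * L :=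
    nhdsWithin_le_nhds (Iic_mem_nhds (by linarith))
  obtain ⟨e, ⟨he, heL⟩, he0⟩ :=
    (((hφ.eventually (Iio_mem_nhds hε)).and hsmall).and self_mem_nhdsWithin).exists
  filter_upwards [hG e he0, hF e he0] with p hGp hFp'
  have h1 := H₁ _ (F p) e (2 * L) (by linarith) hGp (hFp p).to_zero
  have h2 := H₂ (fun t => D.emb (G₀ t)) (F p) F₀ B L e hL heL hG₀ (hFp p) hF₀ hFp'
  have h3 := (h1.add h2).mono (le_of_lt he)
  simpa using h3

/-- Interpolation between small `C^k` and bounded `C^{k+γ}` differences; the strict inequality `α <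
γ` leaves a positive power of the small quantity. -/
theorem TendstoMap.of_exponent_zero {D : NormData d M} [Nonempty M]
    {k : ℕ} {α γ : ℝ} (hγ : 0 < γ) (hα : 0 ≤ α) (hαγ : α < γ) {P : Type*} {l : Filter P}
    {G : P → M → M} {G₀ : M → M} {B : ℝ} (hG : D.TendstoMap k 0 G l G₀)
    (hGp : ∀ p, D.MapBound k γ (fun t => D.emb (G p t)) B)
    (hG₀ : D.MapBound k γ (fun t => D.emb (G₀ t)) B) : D.TendstoMap k α G l G₀ := by
  have hs : 0 < 1 - α / γ := by rw [sub_pos, div_lt_one hγ]; exact hαγ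
  have hB : 0 ≤ B := hG₀.nonneg
  set b := B + B + 1
  have hφ : Tendsto (fun e : ℝ => e ^ (1 - α / γ) * b ^ (α / γ)) (𝓝[>] 0) (𝓝 0) := by
    have hc : ContinuousAt (fun e : ℝ => e ^ (1 - α / γ) * b ^ (α / γ)) 0 :=
      (Real.continuousAt_rpow_const 0 _ (Or.inr hs.le)).mul continuousAt_const
    have := hc.tendsto.mono_left (nhdsWithin_le_nhds (s := Ioi 0))
    simpa [Real.zero_rpow hs.ne'] using this
  intro ε hε
  have hsmall : ∀ᶠ e : ℝ in 𝓝[>] 0, e ≤ b := nhdsWithin_le_nhds (Iic_mem_nhds (by positivity))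
  obtain ⟨e, ⟨he, heb⟩, he0⟩ :=
    (((hφ.eventually (Iio_mem_nhds hε)).and hsmall).and self_mem_nhdsWithin).exists
  filter_upwards [hG e he0] with p hp
  exact (hp.interpolate (((hGp p).sub hG₀).mono (by linarith)) hγ hα hαγ.le heb).mono
    (le_of_lt he)

end NormData

namespace CocycleBound

variable {X : Type u} [MetricSpace X] {d : ℕ} {M : Type v} [TopologicalSpace M]
  [ChartedSpace (EuclideanSpace ℝ (Fin d)) M] {D : NormData d M} {k : ℕ} {γ : ℝ} {f : X → X}
  {A : X → M ≃ₜ M} {β c L η : ℝ}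

theorem tendsto_generator (h : CocycleBound D k γ f A β c L η) (hβ : 0 < β) (x : X) :
    D.TendstoMap k 0 (fun x' t => A x' t) (𝓝 x) (A x) ∧
      D.TendstoMap k 0 (fun x' t => (A x').symm t) (𝓝 x) (A x).symm := by
  have hφ : Tendsto (fun x' => 2 * (c * dist x' x ^ β)) (𝓝 x) (𝓝 0) := by
    have h1 : Tendsto (fun x' => dist x' x) (𝓝 x) (𝓝 0) := by
      simpa using (continuous_id.dist (continuous_const (y := x))).tendsto x
    have h2 := (h1.rpow_const (p := β) (Or.inr hβ.le)).const_mul c |>.const_mul 2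
    simpa [Real.zero_rpow hβ.ne'] using h2
  constructor <;> intro ε hε <;> filter_upwards [hφ.eventually (Iio_mem_nhds hε)] with x' hx'
  · exact (h.holder x' x).to_zero.mono (le_of_lt hx')
  · exact (h.holder_symm x' x).to_zero.mono (le_of_lt hx')

theorem tendsto_iter [IsManifold (𝓡 d) ∞ M] [CompactSpace M] [Nonempty M] (hk : 1 ≤ k)
    (hγ : 0 < γ) (hγ' : γ ≤ 1) (h : CocycleBound D k γ f A β c L η) (hβ : 0 < β)
    (hf : Continuous f) (n : ℕ) (x : X) :
    D.TendstoMap k 0 (fun x' t => cocycleIter f A n x' t) (𝓝 x) (cocycleIter f A n x) ∧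
      D.TendstoMap k 0 (fun x' t => (cocycleIter f A n x').symm t) (𝓝 x)
        (cocycleIter f A n x).symm := by
  have one_le : ∀ m, 1 ≤ L * η ^ m := fun m =>
    one_le_mul_of_one_le_of_one_le h.one_le_const (one_le_pow₀ h.one_le_rate)
  have hLη : 1 ≤ L * η := by simpa using one_le 1
  induction n with
  | zero =>
    constructor <;> intro ε hε <;> refine Eventually.of_forall fun x' c hc => ?_ <;>
    · have : JetBound k 0 (fun _ : EuclideanSpace ℝ (Fin d) => (0 : EuclideanSpace ℝ (Fin D.dim)))
        (D.chartBall c) ε := JetBound.zero.mono hε.le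
      convert! this using 1
      ext1 t
      exact sub_self _
  | succ n ih =>
    have hA := h.tendsto_generator hβ (f^[n] x)
    have hfn : Tendsto (f^[n]) (𝓝 x) (𝓝 (f^[n] x)) := (hf.iterate n).tendsto x
    have h1 := (hA.1.comp_tendsto hfn).comp hk hγ hγ' (one_le n) ih.1 (h.generator _)
      (fun p => h.iter n p) (h.iter n x)
    have h2 := ih.2.comp hk hγ hγ' hLη (hA.2.comp_tendsto hfn) (h.iter_symm n x)
      (fun p => h.generator_symm _) (h.generator_symm _)
    exact ⟨h1, h2⟩

/-- The approximations of the holonomy depend continuously on the points. -/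
theorem tendsto_approx [IsManifold (𝓡 d) ∞ M] [CompactSpace M] [Nonempty M] (hk : 1 ≤ k)
    (hγ : 0 < γ) (hγ' : γ ≤ 1) {α : ℝ} (hα : 0 ≤ α) (hαγ : α < γ)
    (h : CocycleBound D k γ f A β c L η) (hβ : 0 < β) (hf : Continuous f) (n : ℕ) (x y : X) :
    D.TendstoMap k α
      (fun (p : X × X) t => approxHolonomy f A n p.1 p.2 t) (𝓝 (x, y)) (approxHolonomy f A n x y) := by
  have one_le : 1 ≤ L * η ^ n :=
    one_le_mul_of_one_le_of_one_le h.one_le_const (one_le_pow₀ h.one_le_rate)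
  obtain ⟨C₁, hC₁, H₁⟩ := D.exists_comp_bound hk hγ.le hγ'
  have hb : ∀ x y, D.MapBound k γ
      (fun t => D.emb (approxHolonomy f A n x y t))
      (C₁ * (L * η ^ n * (L * η ^ n) ^ (k + 1))) := fun x y =>
    H₁ (fun t => D.emb ((cocycleIter f A n y).symm t)) (cocycleIter f A n x) _ _ one_le
      (h.iter_symm n y) (h.iter n x)
  refine NormData.TendstoMap.of_exponent_zero hγ hα hαγ ?_ (fun p => hb p.1 p.2) (hb x y)
  have := ((h.tendsto_iter hk hγ hγ' hβ hf n y).2.comp_tendsto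
    (continuous_snd.tendsto (x, y))).comp hk hγ hγ' one_le
    ((h.tendsto_iter hk hγ hγ' hβ hf n x).1.comp_tendsto (continuous_fst.tendsto (x, y)))
    (h.iter_symm n y) (fun p => h.iter n p.1) (h.iter n x)
  exact this

end CocycleBound

/-! ## Contraction along stable leaves -/

section Leaf

variable {m : ℕ} {X : Type u} [MetricSpace X] [ChartedSpace (EuclideanSpace ℝ (Fin m)) X]
  [RiemannianBundle (fun x : X => TangentSpace (𝓡 m) x)]

/-- The velocity of a `C^1` curve is continuous up to the endpoints of a compact interval, so the
speed is bounded. -/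
theorem pathELength_lt_top [IsManifold (𝓡 m) ∞ X]
    [h₀ : IsContMDiffRiemannianBundle (𝓡 m) ∞ (EuclideanSpace ℝ (Fin m))
      (fun x : X => TangentSpace (𝓡 m) x)]
    {γ : ℝ → X} (hγ : ContMDiffOn 𝓘(ℝ, ℝ) (𝓡 m) 1 γ (Icc 0 1)) :
    pathELength (𝓡 m) γ 0 1 < ⊤ := by
  have h1 : ContinuousOn (tangentMapWithin 𝓘(ℝ, ℝ) (𝓡 m) γ (Icc 0 1))
      (π ℝ (TangentSpace 𝓘(ℝ, ℝ)) ⁻¹' Icc (0 : ℝ) 1) :=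
    hγ.continuousOn_tangentMapWithin le_rfl
      (uniqueMDiffOn_iff_uniqueDiffOn.2 (uniqueDiffOn_Icc zero_lt_one))
  have h2 : Continuous (fun t : ℝ => (⟨t, (1 : ℝ)⟩ : TangentBundle 𝓘(ℝ, ℝ) ℝ)) :=
    (tangentBundleModelSpaceHomeomorph 𝓘(ℝ, ℝ)).symm.continuous.comp
      (continuous_id.prodMk continuous_const)
  have h3 : ContinuousOn (fun t : ℝ => (⟨γ t, mfderivWithin 𝓘(ℝ, ℝ) (𝓡 m) γ (Icc 0 1) t (1 : ℝ)⟩ :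
      TangentBundle (𝓡 m) X)) (Icc 0 1) :=
    h1.comp h2.continuousOn (fun t ht => ht)
  have : IsContinuousRiemannianBundle (EuclideanSpace ℝ (Fin m))
      (fun x : X => TangentSpace (𝓡 m) x) := by
    obtain ⟨g, hg, hg'⟩ := h₀.exists_contMDiff
    exact ⟨g, hg.continuous, hg'⟩
  have h4 := h3.inner_bundle h3
  obtain ⟨C, hC⟩ := isCompact_Icc.exists_bound_of_continuousOn h4
  rw [pathELength_eq_lintegral_mfderivWithin_Icc]
  have h5 : ∀ t ∈ Icc (0 : ℝ) 1,
      ‖mfderivWithin 𝓘(ℝ, ℝ) (𝓡 m) γ (Icc 0 1) t (1 : ℝ)‖ₑ ≤ ENNReal.ofReal (1 + C) := by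
    intro t ht
    have h6 := hC t ht
    rw [real_inner_self_eq_norm_sq, Real.norm_eq_abs, abs_of_nonneg (sq_nonneg _)] at h6
    rw [← ofReal_norm]
    refine ENNReal.ofReal_le_ofReal ?_
    nlinarith [sq_nonneg (‖mfderivWithin 𝓘(ℝ, ℝ) (𝓡 m) γ (Icc 0 1) t (1 : ℝ)‖ - 1)]
  calc _ ≤ ∫⁻ _ in Icc (0 : ℝ) 1, ENNReal.ofReal (1 + C) :=
        MeasureTheory.setLIntegral_mono measurable_const h5
    _ < ⊤ := by simp

variable {f : X ≃ₜ X} {Es Ec Eu : ∀ x : X, Submodule ℝ (TangentSpace (𝓡 m) x)}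
  {ls lu xs xu : X → ℝ}

theorem IsPartiallyHyperbolic.norm_mfderiv_le (h : IsPartiallyHyperbolic f Es Ec Eu ls lu xs xu)
    (x : X) {w : TangentSpace (𝓡 m) x} (hw : w ∈ Es x) :
    ‖mfderiv (𝓡 m) (𝓡 m) f x w‖ ≤ ls x * ‖w‖ := by
  rcases eq_or_ne w 0 with rfl | hw0
  · simp
  · have hn : ‖w‖ ≠ 0 := norm_ne_zero_iff.2 hw0
    have h1 := h.bound_stable x (‖w‖⁻¹ • w) ((Es x).smul_mem _ hw)
      (by rw [norm_smul, norm_inv, norm_norm, inv_mul_cancel₀ hn])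
    rw [map_smul, norm_smul, norm_inv, norm_norm, inv_mul_eq_div, div_lt_iff₀ (by positivity)] at h1
    exact h1.le

/-- Invariance of the stable bundle preserves tangency, and the pointwise contraction integrates
along the curve. -/
theorem IsTangentCurve.comp (h : IsPartiallyHyperbolic f Es Ec Eu ls lu xs xu) {lam : ℝ}
    (hlam : ∀ x, ls x ≤ lam) {x y : X} {γ : ℝ → X} (hγ : IsTangentCurve Es x y γ) :
    IsTangentCurve Es (f x) (f y) (f ∘ γ) ∧
      pathELength (𝓡 m) (f ∘ γ) 0 1 ≤ ENNReal.ofReal lam * pathELength (𝓡 m) γ 0 1 := by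
  have hd : ∀ s ∈ Icc (0 : ℝ) 1, mfderivWithin 𝓘(ℝ, ℝ) (𝓡 m) (f ∘ γ) (Icc 0 1) s =
      (mfderiv (𝓡 m) (𝓡 m) f (γ s)).comp (mfderivWithin 𝓘(ℝ, ℝ) (𝓡 m) γ (Icc 0 1) s) := by
    intro s hs
    exact mfderiv_comp_mfderivWithin s (h.contMDiff.mdifferentiableAt one_ne_zero)
      (hγ.contMDiffOn.mdifferentiableOn one_ne_zero s hs)
      ((uniqueMDiffOn_iff_uniqueDiffOn.2 (uniqueDiffOn_Icc zero_lt_one)) s hs)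
  refine ⟨⟨h.contMDiff.comp_contMDiffOn hγ.contMDiffOn, ?_, ?_, fun s hs => ?_⟩, ?_⟩
  · simp [hγ.source]
  · simp [hγ.target]
  · rw [hd s hs]
    change _ ∈ Es (f (γ s))
    rw [← h.map_stable (γ s)]
    exact Submodule.mem_map_of_mem (hγ.tangent s hs)
  · rw [pathELength_eq_lintegral_mfderivWithin_Icc, pathELength_eq_lintegral_mfderivWithin_Icc,
      ← MeasureTheory.lintegral_const_mul' _ _ ENNReal.ofReal_ne_top]
    refine MeasureTheory.setLIntegral_mono' measurableSet_Icc fun s hs => ?_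
    have hn := h.norm_mfderiv_le (γ s) (hγ.tangent s hs)
    rw [hd s hs]
    calc _ = ENNReal.ofReal ‖mfderiv (𝓡 m) (𝓡 m) f (γ s)
          (mfderivWithin 𝓘(ℝ, ℝ) (𝓡 m) γ (Icc 0 1) s (1 : ℝ))‖ := (ofReal_norm _).symm
      _ ≤ ENNReal.ofReal (lam * ‖mfderivWithin 𝓘(ℝ, ℝ) (𝓡 m) γ (Icc 0 1) s (1 : ℝ)‖) :=
        ENNReal.ofReal_le_ofReal (hn.trans
          (mul_le_mul_of_nonneg_right (hlam _) (norm_nonneg _)))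
      _ = _ := by
        rw [ENNReal.ofReal_mul ((h.pos_rates x).1.le.trans (hlam x)), ofReal_norm]
        rfl

theorem eventually_mem_leafBall [IsManifold (𝓡 m) ∞ X]
    [IsContMDiffRiemannianBundle (𝓡 m) ∞ (EuclideanSpace ℝ (Fin m))
      (fun x : X => TangentSpace (𝓡 m) x)] (h : IsPartiallyHyperbolic f Es Ec Eu ls lu xs xu)
    {lam : ℝ} (hlam : ∀ x, ls x ≤ lam) (hlam1 : lam < 1) {ρ : ℝ} (hρ : 0 < ρ) {x y : X}
    (hy : y ∈ leaf Es x) : ∃ n : ℕ, f^[n] y ∈ leafBall Es ρ (f^[n] x) := by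
  obtain ⟨γ, hγ⟩ := hy
  have hiter : ∀ n : ℕ, ∃ γ' : ℝ → X, IsTangentCurve Es (f^[n] x) (f^[n] y) γ' ∧
      pathELength (𝓡 m) γ' 0 1 ≤ ENNReal.ofReal lam ^ n * pathELength (𝓡 m) γ 0 1 := by
    intro n
    induction n with
    | zero => exact ⟨γ, hγ, by simp⟩
    | succ n ih =>
      obtain ⟨γ', h1, h2⟩ := ih
      obtain ⟨h3, h4⟩ := h1.comp h hlam
      rw [Function.iterate_succ_apply', Function.iterate_succ_apply']
      refine ⟨_, h3, h4.trans ?_⟩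
      rw [pow_succ', mul_assoc]
      gcongr
  have hlt : ENNReal.ofReal lam < 1 := by simpa using hlam1
  have hlim : Tendsto (fun n : ℕ => ENNReal.ofReal lam ^ n * pathELength (𝓡 m) γ 0 1) atTop
      (𝓝 0) := by
    have := ENNReal.Tendsto.mul_const (ENNReal.tendsto_pow_atTop_nhds_zero_of_lt_one hlt)
      (Or.inr (pathELength_lt_top hγ.contMDiffOn).ne)
    simpa using this
  obtain ⟨n, hn⟩ := (hlim.eventually (Iio_mem_nhds (ENNReal.ofReal_pos.2 hρ))).exists
  obtain ⟨γ', h1, h2⟩ := hiter n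
  exact ⟨n, γ', h1, h2.trans_lt hn⟩

end Leaf
/-! ## Common properties of the base systems -/

/-- In all cases orbits of points of a local stable leaf are contracted at the rate `lam`, and
orbits of points of a stable leaf eventually enter local stable leaves. -/
theorem IsBaseSystem.contracts {X : Type u} [MetricSpace X] {f : X ≃ₜ X} {lam : ℝ}
    {Ws Wloc : X → Set X} (h : IsBaseSystem f lam Ws Wloc) :
    (Nonempty X → 0 < lam ∧ lam < 1) ∧ ContractsLocally f lam Wloc ∧
      ∀ x, ∀ y ∈ Ws x, ∃ n : ℕ, f^[n] y ∈ Wloc (f^[n] x) := by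
  rcases h with h | h | h
  · obtain ⟨m, _, _, _, _, _, Es, Ec, Eu, ls, lu, xs, xu, ρ, -, -, hph, hmax, rfl, hρ, rfl, hc⟩ := h
    obtain ⟨⟨x₀, hx₀⟩, hub⟩ := hmax
    have hlam1 : lam < 1 := hx₀ ▸ (hph.rates_lt_one x₀).1
    exact ⟨fun _ => ⟨hx₀ ▸ (hph.pos_rates x₀).1, hlam1⟩, hc, fun x y hy =>
      eventually_mem_leafBall hph (fun x => hub (mem_range_self x)) hlam1 hρ hy⟩
  · obtain ⟨m, N, _, _, _, _, _, _, F, U, ι, Es, Eu, ls, lu, ε, -, hhs, hmax, hWs, hε, hWloc, hc⟩ :=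
      h
    obtain ⟨⟨x₀, hx₀⟩, hub⟩ := hmax
    refine ⟨fun _ => ⟨hx₀ ▸ (hhs.pos_rates x₀).1, hx₀ ▸ (hhs.rates_lt_one x₀).1⟩, hc,
      fun x y hy => ?_⟩
    rw [hWs] at hy
    obtain ⟨n, hn⟩ := eventually_atTop.1 (hy.eventually (Iic_mem_nhds hε))
    refine ⟨n, ?_⟩
    rw [hWloc]
    intro i
    have := hn (i + n) (Nat.le_add_left n i)
    rwa [Function.iterate_add_apply, Function.iterate_add_apply] at this
  · obtain ⟨l, T, e, h0, h1, hinj, -, hshift, hdist, hWs, hWloc⟩ := h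
    have hiter : ∀ (n : ℕ) x i, e (f^[n] x) i = e x (i + n) := by
      intro n
      induction n with
      | zero => intro x i; simp
      | succ n ih =>
        intro x i
        rw [Function.iterate_succ_apply', hshift, ih]
        congr 1
        push_cast
        ring
    refine ⟨fun _ => ⟨h0, h1⟩, fun x y hy n => ?_, fun x y hy => ?_⟩
    · rw [hWloc] at hy
      rcases eq_or_ne x y with rfl | hxy
      · simp
      · have hne : f^[n] x ≠ f^[n] y := fun hfe => hxy ((f.injective.iterate n) hfe)
        rw [hdist _ _ hne, hdist _ _ hxy, ← pow_add]
        refine pow_le_pow_of_le_one h0.le h1.le ?_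
        refine le_csInf ?_ ?_
        -- Nonemptiness matters because `sInf ∅ = 0`; it holds since distinct points have distinct
        -- codings.
        · by_contra hemp
          refine hne (hinj (funext fun i => ?_))
          by_contra hi
          exact hemp ⟨i.natAbs, i, rfl, hi⟩
        · rintro _ ⟨i, rfl, hi⟩
          rw [hiter, hiter] at hi
          -- A disagreement of the shifted sequences at `i` is one of the originals at `i + n`. As
          -- these agree at nonnegative indices, `i + n < 0`, so `|i| = |i + n| + n`.
          have hneg : i + n < 0 := by
            by_contra! hge
            exact hi (hy _ hge).symm
          have hle : sInf {n : ℕ | ∃ i : ℤ, i.natAbs = n ∧ e x i ≠ e y i} ≤ (i + n).natAbs :=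
            Nat.sInf_le ⟨_, rfl, hi⟩
          omega
    · rw [hWs] at hy
      obtain ⟨n, hn⟩ := hy
      refine ⟨n.toNat, ?_⟩
      rw [hWloc]
      intro i hi
      rw [hiter, hiter]
      exact hn _ (by omega)

/-- Points of a stable leaf are exponentially asymptotic. -/
theorem IsBaseSystem.exists_dist_le {X : Type u} [MetricSpace X] {f : X ≃ₜ X} {lam : ℝ}
    {Ws Wloc : X → Set X} (h : IsBaseSystem f lam Ws Wloc) {x y : X} (hy : y ∈ Ws x) :
    ∃ C : ℝ, 0 ≤ C ∧ ∀ n : ℕ, dist (f^[n] x) (f^[n] y) ≤ C * lam ^ n := by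
  obtain ⟨hlam, hc, hW⟩ := h.contracts
  obtain ⟨h0, h1⟩ := hlam ⟨x⟩
  obtain ⟨N, hN⟩ := hW x y hy
  set S := ∑ i ∈ Finset.range (N + 1), dist (f^[i] x) (f^[i] y)
  have hS : ∀ i ≤ N, dist (f^[i] x) (f^[i] y) ≤ S := fun i hi =>
    Finset.single_le_sum (f := fun i => dist (f^[i] x) (f^[i] y)) (fun _ _ => dist_nonneg)
      (Finset.mem_range.2 (Nat.lt_succ_of_le hi))
  have hS0 : 0 ≤ S := Finset.sum_nonneg fun _ _ => dist_nonneg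
  have hpos : 0 < lam ^ N := by positivity
  -- Before the time `N` of entry into a local leaf, distances are at most `S`; afterwards local
  -- contraction applies. Dividing by `lam ^ N` covers both ranges.
  refine ⟨S / lam ^ N, by positivity, fun n => ?_⟩
  rw [div_mul_eq_mul_div, le_div_iff₀ hpos]
  rcases le_total n N with hn | hn
  · have : lam ^ N ≤ lam ^ n := pow_le_pow_of_le_one h0.le h1.le hn
    exact mul_le_mul (hS n hn) this hpos.le hS0
  · obtain ⟨j, rfl⟩ := Nat.exists_eq_add_of_le hn
    have := hc (f^[N] x) (f^[N] y) hN j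
    rw [← Function.iterate_add_apply, ← Function.iterate_add_apply, add_comm j N] at this
    calc _ ≤ (lam ^ j * S) * lam ^ N := by
          gcongr
          exact this.trans (by gcongr; exact hS N le_rfl)
      _ = _ := by rw [pow_add]; ring

/-! ## Properties of the holonomies -/

theorem NormData.MapBound.sub_comm {d : ℕ} {M : Type v} [TopologicalSpace M]
    [ChartedSpace (EuclideanSpace ℝ (Fin d)) M] {D : NormData d M} {k : ℕ} {α B : ℝ}
    {u u' : M → EuclideanSpace ℝ (Fin D.dim)}
    (h : D.MapBound k α (fun t => u t - u' t) B) : D.MapBound k α (fun t => u' t - u t) B := by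
  intro c hc
  have := (JetBound.zero (k := k) (α := α) (S := D.chartBall c)
    (F := EuclideanSpace ℝ (Fin D.dim))).sub (h c hc)
  simpa [Function.comp_def] using this

namespace ExpAsymptotic

variable {X : Type u} [MetricSpace X] {f : X → X} {lam C₀ C₁ : ℝ} {x y z : X}

theorem refl (f : X → X) (lam : ℝ) (x : X) : ExpAsymptotic f lam 0 x x := ⟨le_rfl, by simp⟩

theorem symm (h : ExpAsymptotic f lam C₀ x y) : ExpAsymptotic f lam C₀ y x :=
  ⟨h.1, fun n => by rw [dist_comm]; exact h.2 n⟩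

theorem trans (h : ExpAsymptotic f lam C₀ x y) (h' : ExpAsymptotic f lam C₁ y z) :
    ExpAsymptotic f lam (C₀ + C₁) x z :=
  ⟨add_nonneg h.1 h'.1, fun n => (dist_triangle _ _ _).trans
    ((add_le_add (h.2 n) (h'.2 n)).trans (by rw [add_mul]))⟩

theorem iterate (h : ExpAsymptotic f lam C₀ x y) (hlam : 0 ≤ lam) (m : ℕ) :
    ExpAsymptotic f lam (C₀ * lam ^ m) (f^[m] x) (f^[m] y) :=
  ⟨mul_nonneg h.1 (by positivity), fun n => by
    rw [← Function.iterate_add_apply, ← Function.iterate_add_apply]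
    refine (h.2 (n + m)).trans (le_of_eq ?_)
    rw [pow_add]; ring⟩

end ExpAsymptotic

theorem cocycleIter_add {X : Type u} {M : Type v} [TopologicalSpace M] (f : X → X)
    (A : X → M ≃ₜ M) (m n : ℕ) (x : X) :
    cocycleIter f A (m + n) x = cocycleIter f A m (f^[n] x) * cocycleIter f A n x := by
  induction m with
  | zero => rw [Nat.zero_add, cocycleIter, one_mul]
  | succ m ih =>
    rw [Nat.succ_add, cocycleIter, ih, cocycleIter, Function.iterate_add_apply, mul_assoc]

theorem approxHolonomy_trans {X : Type u} {M : Type v} [TopologicalSpace M] (f : X → X)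
    (A : X → M ≃ₜ M) (n : ℕ) (x y z : X) :
    approxHolonomy f A n y z * approxHolonomy f A n x y = approxHolonomy f A n x z := by
  simp only [approxHolonomy]
  group

theorem approxHolonomy_self {X : Type u} {M : Type v} [TopologicalSpace M] (f : X → X)
    (A : X → M ≃ₜ M) (n : ℕ) (x : X) : approxHolonomy f A n x x = 1 := by
  simp only [approxHolonomy, inv_mul_cancel]

theorem approxHolonomy_add {X : Type u} {M : Type v} [TopologicalSpace M] (f : X → X)
    (A : X → M ≃ₜ M) (m n : ℕ) (x y : X) :
    approxHolonomy f A (m + n) x y = (cocycleIter f A n y)⁻¹ *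
      approxHolonomy f A m (f^[n] x) (f^[n] y) * cocycleIter f A n x := by
  simp only [approxHolonomy, cocycleIter_add f A m n]
  group

namespace IsHolonomy

variable {X : Type u} [MetricSpace X] {d : ℕ} {M : Type v} [TopologicalSpace M]
  [ChartedSpace (EuclideanSpace ℝ (Fin d)) M] {D : NormData d M} {k : ℕ} {α : ℝ}
  {f : X → X} {A : X → M ≃ₜ M} {lam C τ θ C₀ C₁ : ℝ} {H : X → X → M ≃ₜ M} {x y z : X}

/-- Uniform convergence allows the argument to move with `n`, as is needed to pass to the limit in
compositions. -/
theorem tendsto_apply (h : IsHolonomy D k α f A lam C τ θ H)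
    (hθ : 0 ≤ θ) (hθ' : θ < 1) (hxy : ExpAsymptotic f lam C₀ x y) {s : ℕ → M} {t : M}
    (hs : Tendsto s atTop (𝓝 t)) :
    Tendsto (fun n => D.emb (approxHolonomy f A n x y (s n))) atTop (𝓝 (D.emb (H x y t))) := by
  have h1 : Tendsto (fun n => C * C₀ ^ τ * θ ^ n) atTop (𝓝 0) := by
    simpa using (tendsto_pow_atTop_nhds_zero_of_lt_one hθ hθ').const_mul (C * C₀ ^ τ)
  have h2 : Tendsto (fun n => D.emb (H x y (s n))) atTop (𝓝 (D.emb (H x y t))) :=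
    ((D.emb_smooth.continuous.comp (H x y).continuous).tendsto t).comp hs
  have h3 : Tendsto (fun n => D.emb (H x y (s n)) - D.emb (approxHolonomy f A n x y (s n)))
      atTop (𝓝 0) :=
    squeeze_zero_norm (fun n => (h x y C₀ hxy n).1.norm_apply_le (s n)) h1
  simpa using h2.sub h3

theorem tendsto_apply' [CompactSpace M] (h : IsHolonomy D k α f A lam C τ θ H)
    (hθ : 0 ≤ θ) (hθ' : θ < 1) (hxy : ExpAsymptotic f lam C₀ x y) (t : M) :
    Tendsto (fun n => approxHolonomy f A n x y t) atTop (𝓝 (H x y t)) :=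
  D.isClosedEmbedding_emb.isInducing.tendsto_nhds_iff.2
    (h.tendsto_apply hθ hθ' hxy tendsto_const_nhds)

theorem self (h : IsHolonomy D k α f A lam C τ θ H) (hθ : 0 ≤ θ) (hθ' : θ < 1) (x : X) :
    H x x = 1 := by
  ext t
  refine D.emb_injective (tendsto_nhds_unique
    (h.tendsto_apply hθ hθ' (ExpAsymptotic.refl f lam x) tendsto_const_nhds) ?_)
  simp only [approxHolonomy_self]
  exact tendsto_const_nhds

theorem trans [CompactSpace M] (h : IsHolonomy D k α f A lam C τ θ H) (hθ : 0 ≤ θ) (hθ' : θ < 1)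
    (hxy : ExpAsymptotic f lam C₀ x y) (hyz : ExpAsymptotic f lam C₁ y z) :
    H y z * H x y = H x z := by
  ext t
  refine D.emb_injective (tendsto_nhds_unique
    (h.tendsto_apply hθ hθ' hyz (h.tendsto_apply' hθ hθ' hxy t)) ?_)
  refine (h.tendsto_apply hθ hθ' (hxy.trans hyz) (tendsto_const_nhds (x := t))).congr fun n => ?_
  rw [← approxHolonomy_trans f A n x y z]
  rfl

theorem inv [CompactSpace M] (h : IsHolonomy D k α f A lam C τ θ H) (hθ : 0 ≤ θ) (hθ' : θ < 1)
    (hxy : ExpAsymptotic f lam C₀ x y) : (H x y)⁻¹ = H y x :=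
  inv_eq_of_mul_eq_one_left (by rw [h.trans hθ hθ' hxy hxy.symm, h.self hθ hθ'])

/-- Take `m → ∞` in `approxHolonomy_add`, using that the shifted pair is again asymptotic. -/
theorem invariance [CompactSpace M] (h : IsHolonomy D k α f A lam C τ θ H) (hθ : 0 ≤ θ)
    (hθ' : θ < 1) (hlam : 0 ≤ lam) (hxy : ExpAsymptotic f lam C₀ x y) (n : ℕ) :
    H x y = (cocycleIter f A n y)⁻¹ * H (f^[n] x) (f^[n] y) * cocycleIter f A n x := by
  ext t
  refine D.emb_injective (tendsto_nhds_unique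
    ((h.tendsto_apply hθ hθ' hxy (tendsto_const_nhds (x := t))).comp (tendsto_add_atTop_nat n)) ?_)
  have h1 := h.tendsto_apply' hθ hθ' (hxy.iterate hlam n) (cocycleIter f A n x t)
  have h2 := ((D.emb_smooth.continuous.comp
    (cocycleIter f A n y).symm.continuous).tendsto _).comp h1
  refine h2.congr fun m => ?_
  simp only [Function.comp_apply]
  rw [approxHolonomy_add]
  rfl

theorem diffDist_approx_le (h : IsHolonomy D k α f A lam C τ θ H) (hC : 0 ≤ C) (hθ : 0 ≤ θ)
    (hxy : ExpAsymptotic f lam C₀ x y) (n : ℕ) :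
    D.diffDist k α (approxHolonomy f A n x y) (H x y) ≤
      ENNReal.ofReal (6 * (C * C₀ ^ τ * θ ^ n)) := by
  have := hxy.1
  exact D.diffDist_le_of_mapBound (by positivity) (h x y C₀ hxy n).1.sub_comm
    (h x y C₀ hxy n).2.sub_comm

theorem tendsto_diffDist (h : IsHolonomy D k α f A lam C τ θ H) (hC : 0 ≤ C) (hθ : 0 ≤ θ)
    (hθ' : θ < 1) (hxy : ExpAsymptotic f lam C₀ x y) :
    Tendsto (fun n => D.diffDist k α (approxHolonomy f A n x y) (H x y)) atTop (𝓝 0) := by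
  have h1 : Tendsto (fun n => ENNReal.ofReal (6 * (C * C₀ ^ τ * θ ^ n))) atTop (𝓝 0) := by
    have := ((tendsto_pow_atTop_nhds_zero_of_lt_one hθ hθ').const_mul (C * C₀ ^ τ)).const_mul 6
    rw [mul_zero, mul_zero] at this
    simpa using ENNReal.tendsto_ofReal this
  exact tendsto_of_tendsto_of_tendsto_of_le_of_le tendsto_const_nhds h1 (fun _ => zero_le)
    fun n => h.diffDist_approx_le hC hθ hxy n

/-- The approximation of order `0` is the identity, so this is the convergence estimate at `n = 0`.
-/
theorem diffDist_one_le (h : IsHolonomy D k α f A lam C τ θ H) (hC : 0 ≤ C)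
    (hxy : ExpAsymptotic f lam C₀ x y) :
    D.diffDist k α (H x y) 1 ≤ ENNReal.ofReal (6 * C * C₀ ^ τ) := by
  have h0 := hxy.1
  have h1 := h x y C₀ hxy 0
  rw [pow_zero, mul_one] at h1
  have := D.diffDist_le_of_mapBound (g := H x y) (h := approxHolonomy f A 0 x y) (by positivity)
    h1.1 h1.2
  rw [← mul_assoc] at this
  have e : approxHolonomy f A 0 x y = 1 := by simp [approxHolonomy, cocycleIter]
  rwa [e] at this

theorem memDiff [IsManifold (𝓡 d) ∞ M] [CompactSpace M] [Nonempty M]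
    (h : IsHolonomy D k α f A lam C τ θ H) {L : ℝ} (hL : D.MapBound k α D.emb L)
    (hxy : ExpAsymptotic f lam C₀ x y) : D.MemDiff k α (H x y) := by
  have h1 := h x y C₀ hxy 0
  have e : approxHolonomy f A 0 x y = 1 := by simp [approxHolonomy, cocycleIter]
  rw [e] at h1
  have h2 := h1.1.add hL
  have h3 := h1.2.add hL
  refine D.memDiff_of_mapBound h2.nonneg (fun t => hL.norm_apply_le t) ?_ ?_
  · refine (funext fun t => ?_ : (fun t => D.emb (H x y t)) = _) ▸ h2
    exact (sub_add_cancel _ _).symm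
  · refine (funext fun t => ?_ : (fun t => D.emb ((H x y).symm t)) = _) ▸ h3
    exact (sub_add_cancel _ _).symm

/-- The holonomies depend continuously on the points as long as these are uniformly
asymptotic. -/
theorem tendsto_nhdsWithin [IsManifold (𝓡 d) ∞ M] [CompactSpace M] [Nonempty M]
    (h : IsHolonomy D k α f A lam C τ θ H) (hθ : 0 ≤ θ) (hθ' : θ < 1) {γ β c L η : ℝ}
    (hk : 1 ≤ k) (hγ : 0 < γ) (hγ' : γ ≤ 1) (hα : 0 ≤ α) (hαγ : α < γ)
    (hA : CocycleBound D k γ f A β c L η) (hβ : 0 < β) (hf : Continuous f) {W : Set (X × X)}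
    (hW : ∀ p ∈ W, ExpAsymptotic f lam C₀ p.1 p.2) (hxy : (x, y) ∈ W) :
    Tendsto (fun p : X × X => D.diffDist k α (H p.1 p.2) (H x y)) (𝓝[W] (x, y)) (𝓝 0) := by
  rw [ENNReal.tendsto_nhds_zero]
  intro ε hε
  set e := (min ε 1).toReal with he
  have hmin : min ε 1 ≠ ⊤ := (min_lt_of_right_lt ENNReal.one_lt_top).ne
  have he0 : 0 < e := ENNReal.toReal_pos (lt_min hε one_pos).ne' hmin
  have heε : ENNReal.ofReal e ≤ ε := by
    rw [he, ENNReal.ofReal_toReal hmin]; exact min_le_left _ _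
  have hC₀ : 0 ≤ C₀ := (hW _ hxy).1
  have hlim : Tendsto (fun n => C * C₀ ^ τ * θ ^ n) atTop (𝓝 0) := by
    simpa using (tendsto_pow_atTop_nhds_zero_of_lt_one hθ hθ').const_mul (C * C₀ ^ τ)
  -- Three errors of `e / 18` (two from the limits, one from the approximation) add up to `e / 6`,
  -- and `diffDist_le_of_mapBound` multiplies by `6`. One `n` works for all pairs because `C₀` is
  -- common to `W`.
  obtain ⟨n, hn⟩ := (hlim.eventually (Iio_mem_nhds (by positivity : 0 < e / 18))).exists
  have t1 := hA.tendsto_approx hk hγ hγ' hα hαγ hβ hf n x y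
  have t2 := (hA.tendsto_approx hk hγ hγ' hα hαγ hβ hf n y x).comp_tendsto
    (continuous_swap.tendsto (x, y))
  filter_upwards [self_mem_nhdsWithin, nhdsWithin_le_nhds (t1 (e / 18) (by positivity)),
    nhdsWithin_le_nhds (t2 (e / 18) (by positivity))] with p hp h1 h2
  have a1 := h p.1 p.2 C₀ (hW p hp) n
  have a2 := h x y C₀ (hW _ hxy) n
  have b1 := ((a1.1.add h1).add a2.1.sub_comm).mono (by
    have : C * C₀ ^ τ * θ ^ n < e / 18 := hn
    linarith : _ ≤ e / 6)
  have b2 := ((a1.2.add h2).add a2.2.sub_comm).mono (by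
    have : C * C₀ ^ τ * θ ^ n < e / 18 := hn
    linarith : _ ≤ e / 6)
  refine (D.diffDist_le_of_mapBound (B := e / 6) (by positivity) ?_ ?_).trans
    (le_trans (ENNReal.ofReal_le_ofReal (by linarith)) heε)
  · simpa using b1
  · refine (funext fun t => ?_ : (fun t => D.emb ((H p.1 p.2).symm t) - D.emb ((H x y).symm t)) = _)
      ▸ b2
    change _ = D.emb ((H p.1 p.2).symm t) - D.emb ((approxHolonomy f A n p.1 p.2).symm t) +
      (D.emb ((approxHolonomy f A n p.1 p.2).symm t) - D.emb ((approxHolonomy f A n x y).symm t)) +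
      (D.emb ((approxHolonomy f A n x y).symm t) - D.emb ((H x y).symm t))
    abel

end IsHolonomy

/-! ## Holonomies over hyperbolic and partially hyperbolic systems -/

theorem NormData.diffDist_of_isEmpty {d : ℕ} {M : Type v} [TopologicalSpace M]
    [ChartedSpace (EuclideanSpace ℝ (Fin d)) M] [IsEmpty M] (D : NormData d M) (k : ℕ) (α : ℝ)
    (g h : M ≃ₜ M) : D.diffDist k α g h = 0 := by
  have hc : D.centers = ∅ := Finset.eq_empty_of_isEmpty _
  simp [NormData.diffDist, NormData.vecNorm, NormData.derivNorm, hc]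

theorem NormData.memDiff_of_isEmpty {d : ℕ} {M : Type v} [TopologicalSpace M]
    [ChartedSpace (EuclideanSpace ℝ (Fin d)) M] [IsEmpty M] (D : NormData d M) (k : ℕ) (α : ℝ)
    (g : M ≃ₜ M) : D.MemDiff k α g := by
  have hc : D.centers = ∅ := Finset.eq_empty_of_isEmpty _
  refine ⟨fun x => isEmptyElim x, fun x => isEmptyElim x, ?_⟩
  simp [NormData.size, NormData.mapNorm, NormData.derivNorm, hc]

/-! ### From the hypotheses of the proposition to uniform cocycle bounds -/

theorem contMDiff_cocycleIter {X : Type u} {d : ℕ} {M : Type v} [TopologicalSpace M]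
    [ChartedSpace (EuclideanSpace ℝ (Fin d)) M] {f : X → X} {A : X → M ≃ₜ M} {k : ℕ}
    (hA : ∀ x, ContMDiff (𝓡 d) (𝓡 d) k (A x))
    (hA' : ∀ x, ContMDiff (𝓡 d) (𝓡 d) k (A x).symm) (n : ℕ) (x : X) :
    ContMDiff (𝓡 d) (𝓡 d) k (cocycleIter f A n x) ∧
      ContMDiff (𝓡 d) (𝓡 d) k (cocycleIter f A n x).symm := by
  induction n with
  | zero => exact ⟨contMDiff_id, contMDiff_id⟩
  | succ n ih => exact ⟨(hA _).comp ih.1, ih.2.comp (hA' _)⟩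

/-- The growth hypothesis covers `n ≥ 1` only; order `0` is supplied by the embedding itself.
Enlarging the rate to `max η 1` allows the constant norm of the embedding to be absorbed into `L * η
^ n`. -/
theorem exists_cocycleBound {X : Type u} [MetricSpace X] {d : ℕ} {M : Type v} [TopologicalSpace M]
    [CompactSpace M] [Nonempty M] [ChartedSpace (EuclideanSpace ℝ (Fin d)) M]
    [IsManifold (𝓡 d) ∞ M] (D : NormData d M) {k : ℕ} {γ β : ℝ} (hγ : 0 ≤ γ) (hγ' : γ ≤ 1)
    {f : X → X} {A : X → M ≃ₜ M} (hA : ∀ x, D.MemDiff k γ (A x)) {c : ℝ}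
    (hc : ∀ x y, D.diffDist k γ (A x) (A y) ≤ ENNReal.ofReal (c * dist x y ^ β)) {K η : ℝ}
    (hη : 0 ≤ η)
    (hK : ∀ x, ∀ n : ℕ, 1 ≤ n → D.size k γ (cocycleIter f A n x) ≤ ENNReal.ofReal (K * η ^ n)) :
    ∃ c' L, CocycleBound D k γ f A β c' L (max η 1) := by
  obtain ⟨B, hB⟩ := D.exists_mapBound_emb k hγ hγ'
  have hB0 : 0 ≤ B := hB.nonneg
  have hR : ∀ t, ‖D.emb t‖ ≤ B := hB.norm_apply_le
  have h1 : ∀ n, 1 ≤ max η 1 ^ n := fun n => one_le_pow₀ (le_max_right _ _)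
  have hL : 1 ≤ 2 * (B + |K|) + 1 := by linarith [abs_nonneg K]
  have hiter : ∀ n x, D.MapBound k γ (fun t => D.emb (cocycleIter f A n x t))
        ((2 * (B + |K|) + 1) * max η 1 ^ n) ∧
      D.MapBound k γ (fun t => D.emb ((cocycleIter f A n x).symm t))
        ((2 * (B + |K|) + 1) * max η 1 ^ n) := by
    intro n x
    rcases Nat.eq_zero_or_pos n with rfl | hn
    · have hle : B ≤ (2 * (B + |K|) + 1) * max η 1 ^ 0 := by
        rw [pow_zero, mul_one]; linarith [abs_nonneg K]
      exact ⟨hB.mono hle, hB.mono hle⟩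
    · have hS : D.size k γ (cocycleIter f A n x) ≤ ENNReal.ofReal (|K| * max η 1 ^ n) :=
        (hK x n hn).trans (ENNReal.ofReal_le_ofReal (mul_le_mul (le_abs_self K)
          (pow_le_pow_left₀ hη (le_max_left _ _) n) (by positivity) (abs_nonneg K)))
      obtain ⟨hs, hs'⟩ := contMDiff_cocycleIter (f := f) (fun x => (hA x).contMDiff)
        (fun x => (hA x).contMDiff_symm) n x
      have h2 := D.mapBound_of_size_le hs hs' (by positivity) hB0 hR hS
      have hle : 2 * (B + |K| * max η 1 ^ n) ≤ (2 * (B + |K|) + 1) * max η 1 ^ n := by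
        nlinarith [h1 n]
      exact ⟨h2.1.mono hle, h2.2.mono hle⟩
  have hhol : ∀ x y, D.MapBound k γ (fun t => D.emb (A x t) - D.emb (A y t))
        (2 * |c| * dist x y ^ β) ∧
      D.MapBound k γ (fun t => D.emb ((A x).symm t) - D.emb ((A y).symm t))
        (2 * |c| * dist x y ^ β) := by
    intro x y
    rw [mul_assoc]
    exact D.mapBound_of_diffDist_le (hA x) (hA y) (by positivity) ((hc x y).trans
      (ENNReal.ofReal_le_ofReal (mul_le_mul_of_nonneg_right (le_abs_self c) (by positivity))))
  exact ⟨2 * |c|, 2 * (B + |K|) + 1, hL, le_max_right _ _, by positivity,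
    fun n x => (hiter n x).1, fun n x => (hiter n x).2, fun x y => (hhol x y).1,
    fun x y => (hhol x y).2⟩

/-- If `η ≤ 1`, contraction in the base suffices; otherwise `k + 2 ≤ 2 * (r + 1)`. -/
theorem bunching_max_one_lt {η lam r s : ℝ} {k : ℕ} (hk : 1 ≤ k) (hkr : (k : ℝ) ≤ r)
    (hlam : 0 ≤ lam) (hlam' : lam < 1) (hs : 0 < s)
    (h : η ^ (2 * (r + 1)) * lam ^ s < 1) : max η 1 ^ (k + 2) * lam ^ s < 1 := by
  have hk' : (1 : ℝ) ≤ k := mod_cast hk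
  rcases le_total η 1 with hη | hη
  · rw [max_eq_right hη, one_pow, one_mul]
    exact Real.rpow_lt_one hlam hlam' hs
  · rw [max_eq_left hη]
    refine lt_of_le_of_lt (mul_le_mul_of_nonneg_right ?_ (by positivity)) h
    rw [← Real.rpow_natCast]
    exact Real.rpow_le_rpow_of_exponent_le hη (by push_cast; linarith)

end

theorem proposition3p3
    -- the base system
    {X : Type u} [MetricSpace X] [CompactSpace X] (f : X ≃ₜ X) (lam : ℝ) (Ws Wloc : X → Set X)
    (hbase : IsBaseSystem f lam Ws Wloc)
    -- the fiber
    {d : ℕ} {M : Type v} [TopologicalSpace M] [T2Space M] [CompactSpace M]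
    [ChartedSpace (EuclideanSpace ℝ (Fin d)) M] [IsManifold (𝓡 d) ∞ M] (D : NormData d M)
    -- the exponents: `q = k + γ` with `0 < γ ≤ 1`, and `k ≤ r < q`
    (k : ℕ) (hk : 1 ≤ k) (γ q r β : ℝ) (hγ : 0 < γ) (hγ' : γ ≤ 1) (hq : q = k + γ)
    (hkr : (k : ℝ) ≤ r) (hrq : r < q) (hβ : 0 < β) (hβ' : β ≤ 1)
    -- the `β`-Hölder cocycle
    (A : X → M ≃ₜ M) (hA : ∀ x, D.MemDiff k γ (A x))
    (c : ℝ) (hc : ∀ x y, D.diffDist k γ (A x) (A y) ≤ ENNReal.ofReal (c * dist x y ^ β))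
    -- bunching
    (K η : ℝ) (hη : 0 < η) (hbunch : η ^ (2 * (r + 1)) * lam ^ (β * (q - r)) < 1)
    (hK : ∀ x, ∀ n : ℕ, 1 ≤ n → D.size k γ (cocycleIter f A n x) ≤ ENNReal.ofReal (K * η ^ n)) :
    ∃ H : X → X → (M ≃ₜ M),
      -- the limits exist in `Diff^r(M)`
      (∀ x, ∀ y ∈ Ws x, D.MemDiff k (r - k) (H x y) ∧
        Tendsto (fun n : ℕ => D.diffDist k (r - k)
          ((cocycleIter f A n y)⁻¹ * cocycleIter f A n x) (H x y)) atTop (𝓝 0)) ∧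
      -- (H1)
      (∀ x, H x x = 1) ∧
      (∀ x, ∀ y ∈ Ws x, ∀ z ∈ Ws x, H y z * H x y = H x z) ∧
      (∀ x, ∀ y ∈ Ws x, (H x y)⁻¹ = H y x) ∧
      -- (H2)
      (∀ x, ∀ y ∈ Ws x, ∀ n : ℕ,
        H x y = (cocycleIter f A n y)⁻¹ * H (f^[n] x) (f^[n] y) * cocycleIter f A n x) ∧
      -- (H3)
      (∃ c₁ : ℝ, ∀ x, ∀ y ∈ Wloc x,
        D.diffDist k (r - k) (H x y) 1 ≤ ENNReal.ofReal (c₁ * dist x y ^ (β * (q - r)))) ∧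
      -- (H4)
      (∀ x, ∀ y ∈ Wloc x,
        Tendsto (fun p : X × X => D.diffDist k (r - k) (H p.1 p.2) (H x y))
          (𝓝[{p : X × X | p.2 ∈ Wloc p.1}] (x, y)) (𝓝 0))
  := by
  have hα : (0 : ℝ) ≤ r - k := sub_nonneg.2 hkr
  -- Empty fiber or base is settled separately: nonnegativity of the constants is read off from a
  -- point.
  rcases isEmpty_or_nonempty M with hM | hM
  · have hsub : ∀ g h : M ≃ₜ M, g = h := fun g h => Homeomorph.ext fun t => isEmptyElim t
    refine ⟨fun _ _ => 1, fun x y _ => ⟨D.memDiff_of_isEmpty _ _ _, ?_⟩, fun _ => rfl,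
      fun _ _ _ _ _ => hsub _ _, fun _ _ _ => hsub _ _, fun _ _ _ _ => hsub _ _,
      ⟨0, fun x y _ => ?_⟩, fun x y _ => ?_⟩
    all_goals simp only [D.diffDist_of_isEmpty]
    · exact tendsto_const_nhds
    · exact zero_le
    · exact tendsto_const_nhds
  rcases isEmpty_or_nonempty X with hX | hX
  · exact ⟨fun _ _ => 1, fun x => isEmptyElim x, fun x => isEmptyElim x, fun x => isEmptyElim x,
      fun x => isEmptyElim x, fun x => isEmptyElim x, ⟨0, fun x => isEmptyElim x⟩,
      fun x => isEmptyElim x⟩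
  obtain ⟨hlam, hcontr, -⟩ := hbase.contracts
  obtain ⟨hlam0, hlam1⟩ := hlam hX
  obtain ⟨R, hR⟩ := Metric.isBounded_iff.1 (isCompact_univ (X := X)).isBounded
  have hqr : γ - (r - k) = q - r := by rw [hq]; ring
  have hαγ : r - k < γ := by linarith
  have hR' : ∀ x y : X, dist x y ≤ R := fun x y => hR (mem_univ x) (mem_univ y)
  have hR0 : 0 ≤ R := dist_nonneg.trans (hR' hX.some hX.some)
  obtain ⟨c', L, hA'⟩ := exists_cocycleBound D hγ.le hγ' hA hc hη.le hK
  have hθ' : max η 1 ^ (k + 2) * lam ^ (β * (γ - (r - k))) < 1 := by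
    rw [hqr]
    exact bunching_max_one_lt hk hkr hlam0.le hlam1 (mul_pos hβ (sub_pos.2 hrq)) hbunch
  obtain ⟨C, H, hC, hH⟩ := hA'.exists_holonomy hk hγ hγ' hα hαγ hβ.le hR' hR0 hlam0.le hθ'
  have hθ : 0 ≤ max η 1 ^ (k + 2) * lam ^ (β * (γ - (r - k))) := by positivity
  have hWs : ∀ {x y}, y ∈ Ws x → ∃ C₀, ExpAsymptotic f lam C₀ x y := fun hy =>
    hbase.exists_dist_le hy
  -- On local leaves the asymptotic constant can be the distance itself, which gives the power of
  -- `dist x y` in (H3).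
  have hWloc : ∀ x, ∀ y ∈ Wloc x, ExpAsymptotic f lam (dist x y) x y := fun x y hy =>
    ⟨dist_nonneg, fun n => (hcontr x y hy n).trans_eq (mul_comm _ _)⟩
  -- For (H4) a constant common to all pairs is required, and the diameter bound `R` serves.
  have hWR : ∀ p ∈ {p : X × X | p.2 ∈ Wloc p.1}, ExpAsymptotic f lam R p.1 p.2 := fun p hp =>
    ⟨hR0, fun n => ((hWloc _ _ hp).2 n).trans
      (mul_le_mul_of_nonneg_right (hR' _ _) (by positivity))⟩
  refine ⟨H, fun x y hy => ?_, fun x => hH.self hθ hθ' x, fun x y hy z hz => ?_, fun x y hy => ?_,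
    fun x y hy n => ?_, ⟨6 * C, fun x y hy => ?_⟩, fun x y hy => ?_⟩
  · obtain ⟨C₀, h⟩ := hWs hy
    exact ⟨hH.memDiff ((hA'.emb x).of_exponent_le hγ hα hαγ.le) h,
      hH.tendsto_diffDist hC hθ hθ' h⟩
  · obtain ⟨C₀, h⟩ := hWs hy
    obtain ⟨C₁, h'⟩ := hWs hz
    exact hH.trans hθ hθ' h (h.symm.trans h')
  · obtain ⟨C₀, h⟩ := hWs hy
    exact hH.inv hθ hθ' h
  · obtain ⟨C₀, h⟩ := hWs hy
    exact hH.invariance hθ hθ' hlam0.le h n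
  · rw [← hqr]
    exact hH.diffDist_one_le hC (hWloc x y hy)
  · exact hH.tendsto_nhdsWithin hθ hθ' hk hγ hγ' hα hαγ hA' hβ f.continuous hWR hy
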